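/- Let $\mathbb T=\{t\in\mathbb C: |t|=1\}$ be identified with $\mathbb R/\mathbb Z$ via $\theta\mapsto e^{2\pi i\theta}$, let $m$ be Lebesgue measure on $\mathbb T$ normalized by $m(\mathbb T)=1$, and let $\operatorname{dist}$ be the distance of $\mathbb R/\mathbb Z$. For a finite positive measure $\rho$ on $\mathbb T$ and $n\ge 1$ put $$e_n(\rho)=\min_{q_0,\dots,q_{n-1}\in\mathbb C}\Bigl(\int_{\mathbb T}\bigl|q_0+q_1t+\dots+q_{n-1}t^{n-1}+t^n\bigr|^2\,d\rho(t)\Bigr)^{1/2}.$$ Let $\nu>0$, $\vartheta=\frac{\nu}{\nu+1}$ and $p>\vartheta$. Let $K=\{\exp(2\pi i k^{-\nu}): k=1,2,3,\dots\}\cup\{1\}\subset\mathbb T$, let $d_K(t)=\operatorname{dist}(t,K)$, and let $d\rho=\exp(-d_K^{-p})\,dm$ (the density being $0$ on $K$). Then there are constants $0<c\le C<\infty$, depending only on $\nu$ and $p$, such that for all $n\ge 1$ $$c\,n^{\frac{p-\vartheta}{p+\vartheta}}\le|\log e_n(\rho)|\le C\,n^{\frac{p-\vartheta}{p+\vartheta}}.$$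 -/

import Mathlib

open MeasureTheory

noncomputable section

/-- The circle `𝕋` is identified with `ℝ / ℤ` (`UnitAddCircle`, with its quotient metric and with
`volume` the Lebesgue measure of total mass `1`) by `θ ↦ exp (2 π i θ)`. This is the complex
number of modulus one that corresponds to a point of `ℝ / ℤ`. -/
def circlePoint (t : UnitAddCircle) : ℂ := (AddCircle.toCircle t : ℂ)

/-- The prediction error `e_n(ρ)`: the distance in `L²(ρ)` from `tⁿ` to the polynomials
`q₀ + q₁ t + ⋯ + q_{n-1} t^{n-1}` with complex coefficients, for a finite measure `ρ`. -/
def predictionError (ρ : Measure UnitAddCircle) (n : ℕ) : ℝ :=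
  ⨅ q : Fin n → ℂ, Real.sqrt
    (∫ t, ‖(∑ j : Fin n, q j * circlePoint t ^ (j : ℕ)) + circlePoint t ^ n‖ ^ 2 ∂ρ)

/-- The compact set `K = {exp (2 π i k^{-ν}) : k = 1, 2, …} ∪ {1}` on the circle. -/
def powerSeqSet (ν : ℝ) : Set UnitAddCircle :=
  {t | (∃ k : ℕ, 1 ≤ k ∧
      circlePoint t = Complex.exp (2 * Real.pi * Complex.I * (((k : ℝ) ^ (-ν) : ℝ) : ℂ))) ∨
    circlePoint t = 1}

/-- The density `exp (-d_K^{-p})`, where `d_K (t) = dist (t, K)`, for `p > 0`;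
at distance zero `d_K^{-p} = +∞`, and the density is `0`. -/
def deepZeroDensity (K : Set UnitAddCircle) (p : ℝ) (t : UnitAddCircle) : ℝ :=
  if Metric.infDist t K = 0 then 0 else Real.exp (-(Metric.infDist t K) ^ (-p))

/-- The measure `dρ = exp (-d_K^{-p}) dm`. -/
def deepZeroMeasure (K : Set UnitAddCircle) (p : ℝ) : Measure UnitAddCircle :=
  volume.withDensity fun t => ENNReal.ofReal (deepZeroDensity K p t)

end

/-!
Let `θ = ν / (ν + 1)`, so that the `δ`-neighbourhood `E` of `K` has measure `O(δ ^ θ)`, while `K` is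
`O(ε ^ (1 / θ))`-dense in some arc of length `ε`.

Lower bound. For a monic `P`, Jensen's formula gives `∫ log |P|² ≥ 0`. Off `E` the density is at
least `exp (-δ ^ (-p))` and `∫ d_K ^ (-p) = O(δ ^ (θ - p))` by the layer cake formula, so Jensen's
inequality for the logarithm bounds `∫ |P|² dρ` from below up to `∫_E log |P|²`. The latter is
controlled by the Remez inequality, which says that removing a set of measure `ε` raises the
supremum of `|P|²` by a factor `exp (O(n ε))` at most.

Upper bound. Take for `P` a Chebyshev-type polynomial of the complement of an arc of length `ε` in
which `K` is dense: `|P|²` is at most `exp (-c n ε²)` off the arc and `exp (C n ε)` on it, where the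
density is smaller than `exp (-c ε ^ (-p / θ))`.

Both bounds balance at `δ = n ^ (-1 / (p + θ))` and `ε = δ ^ θ`, up to constants.
-/

section ChebyshevGrowth

open Polynomial Polynomial.Chebyshev

theorem eval_T_half_add_inv_le_pow (n : ℕ) {x : ℝ} (hx : 1 ≤ x) :
    (T ℝ n).eval ((x + x⁻¹) / 2) ≤ x ^ n := by
  have hx0 : 0 < x := by linarith
  have hcosh : (T ℝ n).eval ((x + x⁻¹) / 2) = (x ^ n + (x ^ n)⁻¹) / 2 := by
    rw [← Real.cosh_log hx0, T_real_cosh, ← Real.cosh_log (pow_pos hx0 n), Real.log_pow,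
      Int.cast_natCast]
  have hinv : (x ^ n)⁻¹ ≤ x ^ n := (inv_le_one_of_one_le₀ (one_le_pow₀ hx)).trans (one_le_pow₀ hx)
  linarith

theorem one_add_div_one_sub_le_exp {r : ℝ} (hr0 : 0 ≤ r) (hr : r ≤ 1 / 2) :
    (1 + r) / (1 - r) ≤ Real.exp (3 * r) := by
  have hsub : 0 < 1 - r := by linarith
  have hinv : (1 - r)⁻¹ ≤ Real.exp (2 * r) := by
    refine le_trans ?_ (Real.add_one_le_exp _)
    rw [inv_le_iff_one_le_mul₀ hsub]
    nlinarith
  calc (1 + r) / (1 - r) = (r + 1) * (1 - r)⁻¹ := by rw [add_comm, div_eq_mul_inv]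
    _ ≤ Real.exp r * Real.exp (2 * r) := by
      gcongr
      exact Real.add_one_le_exp r
    _ = Real.exp (3 * r) := by
      rw [← Real.exp_add]
      ring_nf

theorem eval_T_le_exp (n : ℕ) {r : ℝ} (hr0 : 0 ≤ r) (hr : r ≤ 1 / 2) :
    (T ℝ n).eval ((1 + r ^ 2) / (1 - r ^ 2)) ≤ Real.exp (3 * r * n) := by
  have hsub : 0 < 1 - r := by linarith
  have hfactor : 1 - r ^ 2 = (1 - r) * (1 + r) := by ring
  have hx : 1 ≤ (1 + r) / (1 - r) := by rw [le_div_iff₀ hsub]; linarith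
  have hJoukowski :
      (1 + r ^ 2) / (1 - r ^ 2) = ((1 + r) / (1 - r) + ((1 + r) / (1 - r))⁻¹) / 2 := by
    rw [hfactor]
    field_simp
    ring
  rw [hJoukowski, mul_comm, Real.exp_nat_mul]
  exact (eval_T_half_add_inv_le_pow n hx).trans
    (pow_le_pow_left₀ (by linarith) (one_add_div_one_sub_le_exp hr0 hr) n)

end ChebyshevGrowth

section Interpolation

open Polynomial Polynomial.Chebyshev Finset

theorem eval_lagrange_basis {F ι : Type*} [Field F] [DecidableEq ι] (s : Finset ι) (v : ι → F)
    (i : ι) (x : F) :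
    (Lagrange.basis s v i).eval x = ∏ j ∈ s.erase i, (x - v j) / (v i - v j) := by
  simp only [Lagrange.basis, Lagrange.basisDivisor, eval_prod, eval_mul, eval_C, eval_sub, eval_X,
    div_eq_inv_mul]

theorem eval_eq_sum_eval_lagrange_basis {F ι : Type*} [Field F] [DecidableEq ι] {s : Finset ι}
    {v : ι → F} (hv : Set.InjOn v s) {p : F[X]} (hp : p.degree < #s) (x : F) :
    p.eval x = ∑ i ∈ s, p.eval (v i) * (Lagrange.basis s v i).eval x := by
  conv_lhs => rw [Lagrange.eq_interpolate hv hp, Lagrange.interpolate_apply]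
  simp only [eval_finsetSum, eval_mul, eval_C]

theorem sum_abs_eval_lagrange_basis_node {n : ℕ} {y : ℝ} (hy : 1 ≤ y) :
    ∑ i ∈ range (n + 1), |(Lagrange.basis (range (n + 1)) (node n) i).eval y| =
      (T ℝ n).eval y := by
  have hdegree : (T ℝ n).degree < #(range (n + 1)) := by
    rw [degree_T, card_range]
    exact_mod_cast n.lt_succ_self
  rw [eval_eq_sum_eval_lagrange_basis (strictAntiOn_node n).injOn hdegree y]
  refine sum_congr rfl fun i hi => ?_
  have hin : i ≤ n := mem_range_succ_iff.mp hi
  have hnum : ∏ j ∈ (range (n + 1)).erase i, |y - node n j| =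
      ∏ j ∈ (range (n + 1)).erase i, (y - node n j) :=
    prod_congr rfl fun j _ => abs_of_nonneg (by linarith [(node_mem_Icc (n := n) (i := j)).2])
  have hden : ∏ j ∈ (range (n + 1)).erase i, |node n i - node n j| =
      (-1) ^ i * ∏ j ∈ (range (n + 1)).erase i, (node n i - node n j) := by
    rw [← abs_prod, ← abs_of_pos (zero_lt_prod_node_sub_node hin), abs_mul, abs_neg_one_pow,
      one_mul]
  rw [eval_T_real_node (mem_Iic.mpr hin), eval_lagrange_basis, abs_prod]
  simp only [abs_div, prod_div_distrib, hnum, hden]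
  rcases neg_one_pow_eq_or ℝ i with h | h <;> rw [h] <;> simp [div_neg]

theorem div_abs_sub_le_div_abs_sub {a b u v : ℝ} (ha : 0 < a) (hu : 0 < u) (hab : a < b)
    (huv : b / a ≤ v / u) : u / |v - u| ≤ a / |b - a| ∧ v / |v - u| ≤ b / |b - a| := by
  rw [div_le_div_iff₀ ha hu] at huv
  have hlt : u < v := by nlinarith
  rw [abs_of_pos (sub_pos.mpr hlt), abs_of_pos (sub_pos.mpr hab),
    div_le_div_iff₀ (by linarith) (by linarith), div_le_div_iff₀ (by linarith) (by linarith)]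
  constructor <;> nlinarith

/-- Seen from the evaluation point, positive nodes `u` that are at least as spread out, in ratio, as
the distances `y - node` have smaller Lagrange basis polynomials. -/
theorem abs_eval_lagrange_basis_le_of_div_le_div {n i : ℕ} {y : ℝ} {u : ℕ → ℝ} (hy : 1 < y)
    (hu0 : ∀ i ≤ n, 0 < u i)
    (hu : ∀ i j, i < j → j ≤ n → (y - node n j) / (y - node n i) ≤ u j / u i) (hi : i ≤ n) :
    |(Lagrange.basis (range (n + 1)) u i).eval 0| ≤
      |(Lagrange.basis (range (n + 1)) (node n) i).eval y| := by
  have hv0 : ∀ i, 0 < y - node n i := fun i => by linarith [(node_mem_Icc (n := n) (i := i)).2]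
  rw [eval_lagrange_basis, eval_lagrange_basis, abs_prod, abs_prod]
  refine prod_le_prod (fun _ _ => abs_nonneg _) fun j hj => ?_
  obtain ⟨hji, hj⟩ := mem_erase.mp hj
  have hjn : j ≤ n := mem_range_succ_iff.mp hj
  have hsub : node n i - node n j = (y - node n j) - (y - node n i) := by ring
  rw [abs_div, abs_div, zero_sub, abs_neg, abs_of_pos (hu0 j hjn), abs_of_pos (hv0 j), hsub]
  rcases lt_or_gt_of_ne hji with h | h
  · rw [abs_sub_comm (y - node n j)]
    exact (div_abs_sub_le_div_abs_sub (hv0 j) (hu0 j hjn) (by linarith [node_lt hi h])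
      (hu j i h hi)).1
  · rw [abs_sub_comm (u i)]
    exact (div_abs_sub_le_div_abs_sub (hv0 i) (hu0 i hi) (by linarith [node_lt hjn h])
      (hu i j h hjn)).2

theorem abs_eval_zero_le_eval_T {n : ℕ} {p : ℝ[X]} (hp : p.natDegree ≤ n) {A y : ℝ} (hy : 1 < y)
    {u : ℕ → ℝ} (hu0 : ∀ i ≤ n, 0 < u i)
    (hu : ∀ i j, i < j → j ≤ n → (y - node n j) / (y - node n i) ≤ u j / u i)
    (hA : ∀ i ≤ n, |p.eval (u i)| ≤ A) :
    |p.eval 0| ≤ A * (T ℝ n).eval y := by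
  have hv0 : ∀ i, 0 < y - node n i := fun i => by linarith [(node_mem_Icc (n := n) (i := i)).2]
  have hinj : StrictMonoOn u (range (n + 1)) := fun i _ j hj hij => by
    have hjn : j ≤ n := mem_range_succ_iff.mp hj
    have hratio : 1 < (y - node n j) / (y - node n i) := by
      rw [one_lt_div (hv0 i)]
      linarith [node_lt hjn hij]
    exact (one_lt_div (hu0 i (by omega))).mp (hratio.trans_le (hu i j hij hjn))
  have hdegree : p.degree < #(range (n + 1)) := by
    rw [card_range]
    exact degree_le_natDegree.trans_lt (by exact_mod_cast Nat.lt_succ_of_le hp)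
  rw [eval_eq_sum_eval_lagrange_basis hinj.injOn hdegree 0,
    ← sum_abs_eval_lagrange_basis_node hy.le, mul_sum]
  refine (abs_sum_le_sum_abs _ _).trans (sum_le_sum fun i hi => ?_)
  have hin : i ≤ n := mem_range_succ_iff.mp hi
  rw [abs_mul]
  exact mul_le_mul (hA i hin) (abs_eval_lagrange_basis_le_of_div_le_div hy hu0 hu hin)
    (abs_nonneg _) ((abs_nonneg _).trans (hA i hin))

end Interpolation

section Remez

/-- The Lebesgue measure of the part of `F` in `[0, x]`, a continuous stand-in for `x` that does not
see the complement of `F`. -/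
noncomputable def leftMass (F : Set ℝ) (x : ℝ) : ℝ := volume.real (F ∩ Set.Icc 0 x)

theorem volume_inter_Icc_ne_top (F : Set ℝ) (a b : ℝ) : volume (F ∩ Set.Icc a b) ≠ ⊤ :=
  measure_ne_top_of_subset Set.inter_subset_right (by simp)

theorem leftMass_mono (F : Set ℝ) : Monotone (leftMass F) := fun _ y hxy =>
  measureReal_mono (Set.inter_subset_inter_right _ (Set.Icc_subset_Icc_right hxy))
    (volume_inter_Icc_ne_top F 0 y)

theorem leftMass_le_add_sub (F : Set ℝ) {x y : ℝ} (hxy : x ≤ y) :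
    leftMass F y ≤ leftMass F x + (y - x) := by
  have hcover : F ∩ Set.Icc 0 y ⊆ F ∩ Set.Icc 0 x ∪ Set.Icc x y := fun z hz =>
    (le_total z x).imp (fun h => ⟨hz.1, hz.2.1, h⟩) fun h => ⟨h, hz.2.2⟩
  rw [← Real.volume_real_Icc_of_le hxy]
  exact (measureReal_mono hcover
    (measure_union_ne_top (volume_inter_Icc_ne_top F 0 x) (by simp))).trans
    (measureReal_union_le _ _)

theorem continuous_leftMass (F : Set ℝ) : Continuous (leftMass F) := by
  refine (LipschitzWith.of_le_add fun x y => ?_).continuous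
  rcases le_total x y with h | h
  · exact (leftMass_mono F h).trans (le_add_of_nonneg_right dist_nonneg)
  · rw [Real.dist_eq, abs_of_nonneg (sub_nonneg.mpr h)]
    exact leftMass_le_add_sub F h

theorem le_leftMass_add_volume_diff (F : Set ℝ) {x L : ℝ} (hx : 0 ≤ x) (hxL : x ≤ L) :
    x ≤ leftMass F x + volume.real (Set.Icc 0 L \ F) := by
  have hcover : Set.Icc 0 x ⊆ F ∩ Set.Icc 0 x ∪ Set.Icc 0 L \ F := fun z hz =>
    (em (z ∈ F)).imp (fun h => ⟨h, hz⟩) fun h => ⟨⟨hz.1, hz.2.trans hxL⟩, h⟩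
  calc x = volume.real (Set.Icc 0 x) := by rw [Real.volume_real_Icc_of_le hx, sub_zero]
    _ ≤ _ := (measureReal_mono hcover (measure_union_ne_top (volume_inter_Icc_ne_top F 0 x)
      (measure_ne_top_of_subset Set.sdiff_subset (by simp)))).trans (measureReal_union_le _ _)

theorem exists_mem_leftMass_eq {F : Set ℝ} (hF : IsClosed F) {L c : ℝ} (hc0 : 0 < c)
    (hc : c + volume.real (Set.Icc 0 L \ F) ≤ L) :
    ∃ x ∈ F, 0 < x ∧ x ≤ c + volume.real (Set.Icc 0 L \ F) ∧ leftMass F x = c := by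
  have hL : 0 ≤ L := by linarith [measureReal_nonneg (μ := volume) (s := Set.Icc 0 L \ F)]
  have hzero : leftMass F 0 = 0 := by
    simp [leftMass, measureReal_def, measure_mono_null Set.inter_subset_right Real.volume_singleton]
  obtain ⟨y, hy, hyc⟩ : c ∈ leftMass F '' Set.Icc 0 L :=
    intermediate_value_Icc hL (continuous_leftMass F).continuousOn
      ⟨hzero.trans_le hc0.le, by linarith [le_leftMass_add_volume_diff F hL le_rfl]⟩
  have hcompact : IsCompact (F ∩ Set.Icc 0 y) := isCompact_Icc.inter_left hF
  have hne : (F ∩ Set.Icc 0 y).Nonempty := by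
    rw [Set.nonempty_iff_ne_empty]
    intro h
    simp only [leftMass, h, measureReal_empty] at hyc
    linarith
  have hmem := hcompact.sSup_mem hne
  set x := sSup (F ∩ Set.Icc 0 y)
  have hset : F ∩ Set.Icc 0 x = F ∩ Set.Icc 0 y := Set.Subset.antisymm
    (Set.inter_subset_inter_right _ (Set.Icc_subset_Icc_right hmem.2.2))
    fun z hz => ⟨hz.1, hz.2.1, le_csSup hcompact.bddAbove hz⟩
  have hxc : leftMass F x = c := by rw [← hyc, leftMass, hset, leftMass]
  refine ⟨x, hmem.1, hmem.2.1.lt_of_ne fun h => ?_, ?_, hxc⟩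
  · rw [← h, hzero] at hxc
    exact hc0.ne hxc
  · rw [← hxc]
    exact le_leftMass_add_volume_diff F hmem.2.1 (hmem.2.2.trans hy.2)

theorem exists_mem_leftMass_eq_sub {F : Set ℝ} (hF : IsClosed F) {L y ε : ℝ} (hε : 0 < ε)
    (hFε : volume.real (Set.Icc 0 L \ F) ≤ ε) (hy : 2 * ε ≤ y) (hyL : y ≤ L) :
    ∃ x ∈ F, 0 < x ∧ x ≤ y ∧ leftMass F x = y - ε := by
  obtain ⟨x, hxF, hx0, hxle, hmass⟩ :=
    exists_mem_leftMass_eq hF (L := L) (c := y - ε) (by linarith) (by linarith)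
  exact ⟨x, hxF, hx0, by linarith, hmass⟩

theorem sin_div_sin_le_sin_div_sin {a a' b b' : ℝ} (ha : 0 < a) (hab : a ≤ b) (hbb : b ≤ b')
    (hab' : a' ≤ b') (hd : b' - b ≤ a' - a) (hb' : b' ≤ Real.pi / 2) :
    Real.sin b' / Real.sin b ≤ Real.sin a' / Real.sin a := by
  have := Real.pi_pos
  have hsina : 0 < Real.sin a := Real.sin_pos_of_pos_of_lt_pi ha (by linarith)
  have hsinb : 0 < Real.sin b := Real.sin_pos_of_pos_of_lt_pi (by linarith) (by linarith)
  have hshift : Real.sin (a + (b' - b)) ≤ Real.sin a' :=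
    Real.sin_le_sin_of_le_of_le_pi_div_two (by linarith) (by linarith) (by linarith)
  have hprod : 0 ≤ Real.sin (b' - b) * Real.sin (b - a) :=
    mul_nonneg (Real.sin_nonneg_of_nonneg_of_le_pi (by linarith) (by linarith))
      (Real.sin_nonneg_of_nonneg_of_le_pi (by linarith) (by linarith))
  have hcross : Real.sin (a + (b' - b)) * Real.sin b - Real.sin b' * Real.sin a =
      Real.sin (b' - b) * Real.sin (b - a) := by
    have hb : Real.sin b' = Real.sin (b + (b' - b)) := by ring_nf
    rw [hb, Real.sin_add a, Real.sin_add b, Real.sin_sub b a]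
    ring
  rw [div_le_div_iff₀ hsinb hsina]
  nlinarith

open Polynomial Polynomial.Chebyshev

/-- The angles `φ_j ∈ [a, π / 2]` for which `sin² φ_j` are the Chebyshev nodes of the interval
`[sin² a, 1]`, in increasing order. -/
noncomputable def chebyshevAngle (a : ℝ) (n j : ℕ) : ℝ :=
  Real.arcsin √(Real.sin a ^ 2 + Real.cos a ^ 2 * ((1 - node n j) / 2))

theorem sin_chebyshevAngle_radicand_mem_Icc (a : ℝ) (n j : ℕ) :
    Real.sin a ^ 2 + Real.cos a ^ 2 * ((1 - node n j) / 2) ∈ Set.Icc (Real.sin a ^ 2) 1 := by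
  obtain ⟨hge, hle⟩ := node_mem_Icc (n := n) (i := j)
  have hone := Real.sin_sq_add_cos_sq a
  constructor <;> nlinarith [sq_nonneg (Real.cos a)]

theorem sin_chebyshevAngle_sq (a : ℝ) (n j : ℕ) :
    Real.sin (chebyshevAngle a n j) ^ 2 =
      Real.sin a ^ 2 + Real.cos a ^ 2 * ((1 - node n j) / 2) := by
  obtain ⟨hge, hle⟩ := sin_chebyshevAngle_radicand_mem_Icc a n j
  rw [chebyshevAngle, Real.sin_arcsin (neg_one_lt_zero.le.trans (Real.sqrt_nonneg _))
    (Real.sqrt_le_one.mpr hle), Real.sq_sqrt ((sq_nonneg _).trans hge)]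

theorem chebyshevAngle_le_pi_div_two (a : ℝ) (n j : ℕ) : chebyshevAngle a n j ≤ Real.pi / 2 :=
  Real.arcsin_le_pi_div_two _

theorem le_chebyshevAngle {a : ℝ} (ha : a ∈ Set.Icc 0 (Real.pi / 2)) (n j : ℕ) :
    a ≤ chebyshevAngle a n j := by
  obtain ⟨hge, hle⟩ := sin_chebyshevAngle_radicand_mem_Icc a n j
  rw [chebyshevAngle, Real.le_arcsin_iff_sin_le ⟨by linarith [ha.1, Real.pi_pos], ha.2⟩
    ⟨neg_one_lt_zero.le.trans (Real.sqrt_nonneg _), Real.sqrt_le_one.mpr hle⟩]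
  exact Real.le_sqrt_of_sq_le hge

theorem chebyshevAngle_lt_chebyshevAngle {a : ℝ} (ha : Real.cos a ≠ 0) {n i j : ℕ} (hij : i < j)
    (hj : j ≤ n) : chebyshevAngle a n i < chebyshevAngle a n j := by
  have hrange : ∀ k, √(Real.sin a ^ 2 + Real.cos a ^ 2 * ((1 - node n k) / 2)) ∈ Set.Icc (-1) 1 :=
    fun k => ⟨neg_one_lt_zero.le.trans (Real.sqrt_nonneg _),
      Real.sqrt_le_one.mpr (sin_chebyshevAngle_radicand_mem_Icc a n k).2⟩
  refine Real.strictMonoOn_arcsin (hrange i) (hrange j) (Real.sqrt_lt_sqrt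
    ((sq_nonneg _).trans (sin_chebyshevAngle_radicand_mem_Icc a n i).1) ?_)
  have : 0 < Real.cos a ^ 2 := by positivity
  gcongr
  exact node_lt hj hij

theorem sin_chebyshevAngle_nonneg (a : ℝ) (n j : ℕ) : 0 ≤ Real.sin (chebyshevAngle a n j) := by
  rw [chebyshevAngle]
  exact Real.sin_nonneg_of_nonneg_of_le_pi (Real.arcsin_nonneg.mpr (Real.sqrt_nonneg _))
    ((Real.arcsin_le_pi_div_two _).trans (half_le_self Real.pi_pos.le))

theorem exists_mem_sin_chebyshevAngle_div_le {F : Set ℝ} (hF : IsClosed F) {ε : ℝ} (hε0 : 0 < ε)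
    (hε : 4 * ε < 1) (hFε : volume.real (Set.Icc 0 (1 / 2) \ F) ≤ ε) (n : ℕ) :
    ∃ x : ℕ → ℝ, (∀ j, x j ∈ F ∧ 0 < Real.sin (Real.pi * x j)) ∧ ∀ i j, i < j → j ≤ n →
      Real.sin (chebyshevAngle (2 * Real.pi * ε) n j) /
        Real.sin (chebyshevAngle (2 * Real.pi * ε) n i) ≤
      Real.sin (Real.pi * x j) / Real.sin (Real.pi * x i) := by
  have hpi := Real.pi_pos
  set a := 2 * Real.pi * ε
  have ha0 : 0 < a := by positivity
  have haπ : a < Real.pi / 2 := by nlinarith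
  have hcos : Real.cos a ≠ 0 := (Real.cos_pos_of_mem_Ioo ⟨by linarith, haπ⟩).ne'
  have hle : ∀ j, a ≤ chebyshevAngle a n j := le_chebyshevAngle ⟨ha0.le, haπ.le⟩ n
  have hex (j : ℕ) := exists_mem_leftMass_eq_sub hF hε0 hFε
    (y := chebyshevAngle a n j / Real.pi)
    (by rw [le_div_iff₀ hpi]; linarith [hle j])
    (by rw [div_le_iff₀ hpi]; linarith [chebyshevAngle_le_pi_div_two a n j])
  choose x hxF hx0 hxle hmass using hex
  simp only [le_div_iff₀' hpi] at hxle
  have hsin : ∀ j, 0 < Real.sin (Real.pi * x j) := fun j => Real.sin_pos_of_pos_of_lt_pi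
    (mul_pos hpi (hx0 j)) (by linarith [hxle j, chebyshevAngle_le_pi_div_two a n j])
  refine ⟨x, fun j => ⟨hxF j, hsin j⟩, fun i j hij hj => ?_⟩
  have hlt := chebyshevAngle_lt_chebyshevAngle hcos hij hj
  have hxij : x i < x j := (leftMass_mono F).reflect_lt (by
    rw [hmass, hmass]
    gcongr)
  have hgap : (chebyshevAngle a n j - chebyshevAngle a n i) / Real.pi ≤ x j - x i := by
    have hstep := leftMass_le_add_sub F hxij.le
    rw [hmass, hmass] at hstep
    rw [sub_div]
    linarith
  rw [div_le_iff₀' hpi, mul_sub] at hgap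
  exact sin_div_sin_le_sin_div_sin (mul_pos hpi (hx0 i)) (hxle i) hlt.le (hxle j) hgap
    (chebyshevAngle_le_pi_div_two a n j)

/-- A Remez inequality: the points of `F` to the left of which `F` has mass `φ_j / π - ε` are at
least as spread out as the Chebyshev angles `φ_j`, because `leftMass F` is a contraction. -/
theorem abs_eval_zero_le_of_abs_eval_sin_sq_le {n : ℕ} {p : ℝ[X]} (hp : p.natDegree ≤ n)
    {F : Set ℝ} (hF : IsClosed F) {ε A : ℝ} (hε0 : 0 < ε) (hε : ε ≤ 1 / 16)
    (hFε : volume.real (Set.Icc 0 (1 / 2) \ F) ≤ ε)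
    (hA : ∀ x ∈ F, |p.eval (Real.sin (Real.pi * x) ^ 2)| ≤ A) :
    |p.eval 0| ≤ A * Real.exp (6 * Real.pi * ε * n) := by
  have hpi := Real.pi_pos
  obtain ⟨x, hx, hratio⟩ :=
    exists_mem_sin_chebyshevAngle_div_le hF hε0 (by linarith) hFε n
  set a := 2 * Real.pi * ε
  set r := Real.sin a
  have hr0 : 0 < r := Real.sin_pos_of_pos_of_lt_pi (by positivity) (by nlinarith)
  have hra : r ≤ a := Real.sin_le (by positivity)
  have hr2 : r ≤ 1 / 2 := by nlinarith [Real.pi_lt_four]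
  have hcos : Real.cos a ^ 2 = 1 - r ^ 2 := Real.cos_sq' a
  have hcos0 : 0 < 1 - r ^ 2 := by nlinarith
  set y := (1 + r ^ 2) / (1 - r ^ 2) with hy
  have hy1 : 1 < y := by rw [hy, one_lt_div hcos0]; nlinarith
  have hangle : ∀ j, Real.sin (chebyshevAngle a n j) ^ 2 = (1 - r ^ 2) / 2 * (y - node n j) :=
    fun j => by
      rw [sin_chebyshevAngle_sq, hcos, hy]
      field_simp
      ring
  have hAT : |p.eval 0| ≤ A * (T ℝ n).eval y := by
    refine abs_eval_zero_le_eval_T hp hy1 (u := fun j => Real.sin (Real.pi * x j) ^ 2)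
      (fun j _ => pow_pos (hx j).2 2) (fun i j hij hj => ?_) fun j _ => hA _ (hx j).1
    rw [← mul_div_mul_left _ _ (half_pos hcos0).ne', ← hangle, ← hangle, ← div_pow, ← div_pow]
    refine pow_le_pow_left₀ (div_nonneg (sin_chebyshevAngle_nonneg a n j)
      (sin_chebyshevAngle_nonneg a n i)) (hratio i j hij hj) 2
  have hA0 : 0 ≤ A := (abs_nonneg _).trans (hA _ (hx 0).1)
  refine hAT.trans (mul_le_mul_of_nonneg_left ((eval_T_le_exp n hr0.le hr2).trans ?_) hA0)
  rw [show 6 * Real.pi * ε = 3 * a by ring]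
  gcongr

end Remez

section CircleRemez

theorem circlePoint_coe (θ : ℝ) : circlePoint (θ : UnitAddCircle) =
    Complex.exp ((2 * Real.pi * θ : ℝ) * Complex.I) := by
  rw [circlePoint, AddCircle.toCircle_apply_mk, Circle.coe_exp, div_one]

theorem norm_circlePoint (t : UnitAddCircle) : ‖circlePoint t‖ = 1 := Circle.norm_coe _

theorem circlePoint_add (s t : UnitAddCircle) :
    circlePoint (s + t) = circlePoint s * circlePoint t := by
  simp [circlePoint, AddCircle.toCircle_add]

theorem circlePoint_injective : Function.Injective circlePoint :=
  Subtype.val_injective.comp (AddCircle.injective_toCircle one_ne_zero)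

theorem continuous_circlePoint : Continuous circlePoint :=
  continuous_subtype_val.comp AddCircle.continuous_toCircle

open Polynomial Polynomial.Chebyshev ComplexConjugate Finset

theorem norm_sq_eval_mul_exp_eq_sum {n : ℕ} {Q : ℂ[X]} (hQ : Q.natDegree ≤ n) (w : ℂ) (η : ℝ) :
    ‖Q.eval (w * Complex.exp (η * Complex.I))‖ ^ 2 =
      ∑ j ∈ range (n + 1), ∑ k ∈ range (n + 1), (Q.coeff j * w ^ j * conj (Q.coeff k * w ^ k) *
        Complex.exp (((((j : ℤ) - k : ℤ) : ℝ) * η : ℝ) * Complex.I)).re := by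
  have hnorm : ∀ z : ℂ, ‖z‖ ^ 2 = (z * conj z).re := fun z => by
    rw [Complex.mul_conj, Complex.ofReal_re, Complex.normSq_eq_norm_sq]
  rw [hnorm, eval_eq_sum_range' (Nat.lt_succ_of_le hQ), map_sum, sum_mul_sum, Complex.re_sum]
  refine sum_congr rfl fun j _ => ?_
  rw [Complex.re_sum]
  refine sum_congr rfl fun k _ => congrArg Complex.re ?_
  have hexp : Complex.exp (((((j : ℤ) - k : ℤ) : ℝ) * η : ℝ) * Complex.I) =
      Complex.exp (η * Complex.I) ^ j * conj (Complex.exp (η * Complex.I)) ^ k := by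
    rw [← Complex.exp_conj, ← Complex.exp_nat_mul, ← Complex.exp_nat_mul, ← Complex.exp_add]
    simp only [map_mul, Complex.conj_I, Complex.conj_ofReal]
    push_cast
    ring_nf
  rw [hexp]
  simp only [map_mul, map_pow]
  ring

theorem re_mul_exp_mul_I_add_re_mul_exp_neg_mul_I (β : ℂ) (η : ℝ) :
    (β * Complex.exp (η * Complex.I)).re + (β * Complex.exp ((-η : ℝ) * Complex.I)).re =
      2 * (β.re * Real.cos η) := by
  rw [Complex.mul_re, Complex.mul_re, Complex.exp_ofReal_mul_I_re, Complex.exp_ofReal_mul_I_re,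
    Complex.exp_ofReal_mul_I_im, Complex.exp_ofReal_mul_I_im, Real.cos_neg, Real.sin_neg]
  ring

theorem exists_eval_sin_sq_eq_norm_sq_add_norm_sq {n : ℕ} {Q : ℂ[X]} (hQ : Q.natDegree ≤ n)
    (w : ℂ) : ∃ p : ℝ[X], p.natDegree ≤ n ∧ ∀ ψ : ℝ, p.eval (Real.sin ψ ^ 2) =
      (‖Q.eval (w * Complex.exp ((2 * ψ : ℝ) * Complex.I))‖ ^ 2 +
        ‖Q.eval (w * Complex.exp ((-(2 * ψ) : ℝ) * Complex.I))‖ ^ 2) / 2 := by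
  refine ⟨∑ j ∈ range (n + 1), ∑ k ∈ range (n + 1),
    C ((Q.coeff j * w ^ j * conj (Q.coeff k * w ^ k)).re) * (T ℝ ((j : ℤ) - k)).comp (1 - 2 * X),
    natDegree_sum_le_of_forall_le _ _ fun j hj =>
      natDegree_sum_le_of_forall_le _ _ fun k hk => ?_, fun ψ => ?_⟩
  · have hlin : (1 - 2 * X : ℝ[X]).natDegree ≤ 1 := by compute_degree
    have hT : (T ℝ ((j : ℤ) - k)).natDegree ≤ n := by
      rw [natDegree_T]
      simp only [mem_range] at hj hk
      omega
    calc _ ≤ _ := (natDegree_C_mul_le _ _).trans natDegree_comp_le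
      _ ≤ n * 1 := Nat.mul_le_mul hT hlin
      _ = n := mul_one n
  · have hcos : (1 - 2 * X : ℝ[X]).eval (Real.sin ψ ^ 2) = Real.cos (2 * ψ) := by
      simp only [eval_sub, eval_one, eval_mul, eval_ofNat, eval_X]
      rw [Real.cos_two_mul, Real.cos_sq']
      ring
    rw [norm_sq_eval_mul_exp_eq_sum hQ, norm_sq_eval_mul_exp_eq_sum hQ, ← sum_add_distrib, sum_div,
      eval_finsetSum]
    refine sum_congr rfl fun j _ => ?_
    rw [← sum_add_distrib, sum_div, eval_finsetSum]
    refine sum_congr rfl fun k _ => ?_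
    rw [eval_mul, eval_C, eval_comp, hcos, T_real_cos, mul_neg,
      re_mul_exp_mul_I_add_re_mul_exp_neg_mul_I, mul_div_cancel_left₀ _ two_ne_zero]

theorem measurePreserving_coe_unitAddCircle :
    MeasurePreserving ((↑) : ℝ → UnitAddCircle) (volume.restrict (Set.Ioc 0 1)) volume := by
  simpa using UnitAddCircle.measurePreserving_mk 0

theorem volume_real_Icc_inter_preimage_le {s : ℝ → UnitAddCircle} {G : Set UnitAddCircle}
    (hG : MeasurableSet G) (hs : MeasurePreserving s (volume.restrict (Set.Ioc 0 1)) volume) :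
    volume.real (Set.Icc (0 : ℝ) (1 / 2) ∩ s ⁻¹' G) ≤ volume.real G := by
  have hIoc : volume (s ⁻¹' G ∩ Set.Ioc 0 1) = volume G := by
    rw [← hs.measure_preimage hG.nullMeasurableSet, Measure.restrict_apply (hs.measurable hG)]
  have hsub : Set.Icc (0 : ℝ) (1 / 2) ∩ s ⁻¹' G ⊆ s ⁻¹' G ∩ Set.Ioc 0 1 ∪ {0} := fun x hx =>
    hx.1.1.eq_or_lt.elim (fun h => Or.inr h.symm) fun h => Or.inl ⟨hx.2, h, by linarith [hx.1.2]⟩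
  refine ENNReal.toReal_mono (measure_ne_top _ _) ((measure_mono hsub).trans
    ((measure_union_le _ _).trans ?_))
  rw [hIoc, Real.volume_singleton, add_zero]

theorem volume_real_Icc_diff_preimage_inter_le {F : Set UnitAddCircle} (hF : MeasurableSet F)
    (t₀ : UnitAddCircle) :
    volume.real (Set.Icc (0 : ℝ) (1 / 2) \
      ((fun x : ℝ => t₀ + (x : UnitAddCircle)) ⁻¹' F ∩
        (fun x : ℝ => t₀ - (x : UnitAddCircle)) ⁻¹' F)) ≤ 2 * volume.real Fᶜ := by
  have hadd := volume_real_Icc_inter_preimage_le hF.compl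
    ((measurePreserving_add_left volume t₀).comp measurePreserving_coe_unitAddCircle)
  have hsub := volume_real_Icc_inter_preimage_le hF.compl
    ((Measure.measurePreserving_sub_left volume t₀).comp measurePreserving_coe_unitAddCircle)
  rw [Set.sdiff_inter, two_mul]
  exact (measureReal_union_le _ _).trans (add_le_add hadd hsub)

/-- Remez inequality on the circle. It reduces to the one at the origin because the even part of
`|Q|²` about `t₀` is a polynomial in `sin²` of half the angle. -/
theorem norm_sq_eval_circlePoint_le_mul_exp {n : ℕ} {Q : ℂ[X]} (hQ : Q.natDegree ≤ n)
    {F : Set UnitAddCircle} (hF : IsClosed F) {ε A : ℝ} (hε0 : 0 < ε) (hε : ε ≤ 1 / 32)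
    (hFε : volume.real Fᶜ ≤ ε) (hA : ∀ t ∈ F, ‖Q.eval (circlePoint t)‖ ^ 2 ≤ A)
    (t₀ : UnitAddCircle) :
    ‖Q.eval (circlePoint t₀)‖ ^ 2 ≤ A * Real.exp (12 * Real.pi * ε * n) := by
  obtain ⟨p, hp, hpe⟩ := exists_eval_sin_sq_eq_norm_sq_add_norm_sq hQ (circlePoint t₀)
  have hmk : Continuous ((↑) : ℝ → UnitAddCircle) := AddCircle.continuous_mk' 1
  have heven : ∀ x : ℝ, p.eval (Real.sin (Real.pi * x) ^ 2) =
      (‖Q.eval (circlePoint (t₀ + x))‖ ^ 2 + ‖Q.eval (circlePoint (t₀ - x))‖ ^ 2) / 2 := fun x => by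
    rw [hpe]
    simp only [sub_eq_add_neg, circlePoint_add, ← AddCircle.coe_neg, circlePoint_coe]
    ring_nf
  have hcenter : p.eval 0 = ‖Q.eval (circlePoint t₀)‖ ^ 2 := by simpa using hpe 0
  have hRemez := abs_eval_zero_le_of_abs_eval_sin_sq_le hp
    ((hF.preimage (continuous_const.add hmk)).inter (hF.preimage (continuous_const.sub hmk)))
    (ε := 2 * ε) (A := A) (by linarith) (by linarith)
    ((volume_real_Icc_diff_preimage_inter_le hF.measurableSet t₀).trans (by linarith))
    fun x hx => by
      have hplus : ‖Q.eval (circlePoint (t₀ + x))‖ ^ 2 ≤ A := hA _ hx.1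
      have hminus : ‖Q.eval (circlePoint (t₀ - x))‖ ^ 2 ≤ A := hA _ hx.2
      rw [heven, abs_of_nonneg (by positivity)]
      linarith
  rw [hcenter, abs_of_nonneg (sq_nonneg _)] at hRemez
  convert hRemez using 3
  ring

end CircleRemez

section SzegoLowerBound

open Polynomial

theorem integrable_log_norm_eval_circlePoint (P : ℂ[X]) :
    Integrable fun t : UnitAddCircle => Real.log ‖P.eval (circlePoint t)‖ := by
  have hmeas : Measurable fun t : UnitAddCircle => Real.log ‖P.eval (circlePoint t)‖ :=
    (P.continuous.comp continuous_circlePoint).norm.measurable.log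
  have hMahler := (intervalIntegrable_mahlerMeasure (p := P)).comp_mul_left (c := 2 * Real.pi)
  rw [zero_div, div_self Real.two_pi_pos.ne',
    intervalIntegrable_iff_integrableOn_Ioc_of_le zero_le_one] at hMahler
  rw [← measurePreserving_coe_unitAddCircle.integrable_comp hmeas.aestronglyMeasurable]
  refine hMahler.congr (Filter.Eventually.of_forall fun x => ?_)
  simp only [Function.comp, circlePoint_coe, circleMap, zero_add, Complex.ofReal_one, one_mul]

theorem integral_log_norm_eval_circlePoint (P : ℂ[X]) :
    ∫ t : UnitAddCircle, Real.log ‖P.eval (circlePoint t)‖ = P.logMahlerMeasure := by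
  rw [logMahlerMeasure_def, Real.circleAverage_def, ← UnitAddCircle.intervalIntegral_preimage 0]
  have hscale := intervalIntegral.integral_comp_mul_left (a := 0) (b := 1)
    (fun x => Real.log ‖P.eval (circleMap 0 1 x)‖) Real.two_pi_pos.ne'
  rw [mul_zero, mul_one] at hscale
  rw [← hscale, zero_add]
  refine intervalIntegral.integral_congr fun x _ => ?_
  simp only [circlePoint_coe, circleMap, zero_add, Complex.ofReal_one, one_mul]

theorem log_norm_sq_eval_eq_two_mul (P : ℂ[X]) (t : UnitAddCircle) :
    Real.log (‖P.eval (circlePoint t)‖ ^ 2) = 2 * Real.log ‖P.eval (circlePoint t)‖ := by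
  rw [Real.log_pow, Nat.cast_ofNat]

theorem integrable_log_norm_sq_eval (P : ℂ[X]) :
    Integrable fun t : UnitAddCircle => Real.log (‖P.eval (circlePoint t)‖ ^ 2) := by
  simpa only [log_norm_sq_eval_eq_two_mul] using
    (integrable_log_norm_eval_circlePoint P).const_mul 2

theorem integral_log_norm_sq_eval_nonneg {P : ℂ[X]} (hP : P.Monic) :
    0 ≤ ∫ t : UnitAddCircle, Real.log (‖P.eval (circlePoint t)‖ ^ 2) := by
  simp only [log_norm_sq_eval_eq_two_mul, integral_const_mul, integral_log_norm_eval_circlePoint,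
    logMahlerMeasure_eq_log_MahlerMeasure]
  exact mul_nonneg zero_le_two
    (Real.log_nonneg (one_le_mahlerMeasure_of_one_le_norm_leadingCoeff (by simp [hP])))

theorem ae_eval_circlePoint_ne_zero {P : ℂ[X]} (hP : P ≠ 0) :
    ∀ᵐ t : UnitAddCircle, P.eval (circlePoint t) ≠ 0 := by
  have hfinite : {t : UnitAddCircle | P.eval (circlePoint t) = 0}.Finite := by
    refine Set.Finite.preimage circlePoint_injective.injOn (s := {z | P.eval z = 0})
      (P.roots.toFinset.finite_toSet.subset fun z hz => ?_)
    simpa [hP] using hz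
  have hatom : NullSingletonClass (volume : Measure UnitAddCircle) :=
    ⟨fun x => by simpa using AddCircle.volume_closedBall (T := 1) (x := x) 0⟩
  simpa [ae_iff] using hfinite.measure_zero volume

theorem integrable_norm_sq_eval_mul (P : ℂ[X]) {W : UnitAddCircle → ℝ} (hW : Integrable W) :
    Integrable fun t => ‖P.eval (circlePoint t)‖ ^ 2 * W t := by
  have hcont : Continuous fun t : UnitAddCircle => ‖P.eval (circlePoint t)‖ ^ 2 :=
    (P.continuous.comp continuous_circlePoint).norm.pow 2
  obtain ⟨C, hC⟩ := (isCompact_range hcont).isBounded.exists_norm_le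
  exact hW.bdd_mul hcont.aestronglyMeasurable (Filter.Eventually.of_forall fun t => hC _ ⟨t, rfl⟩)

theorem integral_norm_sq_eval_mul_pos {P : ℂ[X]} (hP : P ≠ 0) {W : UnitAddCircle → ℝ}
    (hW : Integrable W) (hW0 : ∀ t, 0 ≤ W t) {F : Set UnitAddCircle} (hF : volume F ≠ 0)
    (hWF : ∀ t ∈ F, 0 < W t) : 0 < ∫ t, ‖P.eval (circlePoint t)‖ ^ 2 * W t := by
  rw [integral_pos_iff_support_of_nonneg (fun t => mul_nonneg (sq_nonneg _) (hW0 t))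
    (integrable_norm_sq_eval_mul P hW)]
  refine (pos_iff_ne_zero.mpr hF).trans_le (measure_mono_ae ?_)
  filter_upwards [ae_eval_circlePoint_ne_zero hP] with t ht htF
  exact mul_ne_zero (pow_ne_zero 2 (norm_ne_zero_iff.mpr ht)) (hWF t htF).ne'

theorem measureReal_integral_div_le_le {α : Type*} [MeasurableSpace α] {μ : Measure α} {g : α → ℝ}
    (hg0 : 0 ≤ᵐ[μ] g) (hg : Integrable g μ) (hpos : 0 < ∫ x, g x ∂μ) {ε : ℝ} (hε : 0 < ε) :
    μ.real {x | (∫ x, g x ∂μ) / ε ≤ g x} ≤ ε := by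
  have hMarkov := mul_meas_ge_le_integral_of_nonneg hg0 hg ((∫ x, g x ∂μ) / ε)
  rw [div_mul_eq_mul_div, div_le_iff₀ hε] at hMarkov
  exact le_of_mul_le_mul_left hMarkov hpos

theorem integral_log_le_of_integral_mul_le {α : Type*} [MeasurableSpace α] {μ : Measure α}
    [IsFiniteMeasure μ] {f W : α → ℝ} (hf : ∀ᵐ x ∂μ, 0 < f x) (hW : ∀ᵐ x ∂μ, 0 < W x)
    (hlogf : Integrable (fun x => Real.log (f x)) μ)
    (hlogW : Integrable (fun x => Real.log (W x)) μ) (hfW : Integrable (fun x => f x * W x) μ)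
    {X : ℝ} (hX : 0 < X) (hle : ∫ x, f x * W x ∂μ ≤ X) :
    ∫ x, Real.log (f x) ∂μ ≤ -∫ x, Real.log (W x) ∂μ + μ.real Set.univ * Real.log X + 1 := by
  have hdiff : Integrable (fun x => Real.log X - Real.log (W x)) μ :=
    (integrable_const _).sub hlogW
  calc ∫ x, Real.log (f x) ∂μ ≤ ∫ x, (Real.log X - Real.log (W x) + f x * W x / X) ∂μ := by
        refine integral_mono_ae hlogf (hdiff.add (hfW.div_const X)) ?_
        filter_upwards [hf, hW] with x hfx hWx
        have hlog := Real.log_le_sub_one_of_pos (show 0 < f x * W x / X by positivity)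
        rw [Real.log_div (by positivity) hX.ne', Real.log_mul hfx.ne' hWx.ne'] at hlog
        linarith
    _ = μ.real Set.univ * Real.log X - ∫ x, Real.log (W x) ∂μ + (∫ x, f x * W x ∂μ) / X := by
        rw [integral_add hdiff (hfW.div_const X), integral_sub (integrable_const _) hlogW,
          integral_const, smul_eq_mul, integral_div]
    _ ≤ _ := by linarith [(div_le_one hX).mpr hle]

instance isProbabilityMeasure_volume_unitAddCircle :
    IsProbabilityMeasure (volume : Measure UnitAddCircle) :=
  ⟨UnitAddCircle.measure_univ⟩

theorem one_half_le_volume_real_compl {E : Set UnitAddCircle} (hE : MeasurableSet E)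
    (hvol : volume.real E ≤ 1 / 2) : 1 / 2 ≤ volume.real Eᶜ := by
  rw [probReal_compl_eq_one_sub hE]
  linarith

variable {n : ℕ} {P : ℂ[X]} {W : UnitAddCircle → ℝ} {E : Set UnitAddCircle} {ε M : ℝ}

theorem norm_sq_eval_le_integral_norm_sq_mul (hP : P ≠ 0) (hn : P.natDegree ≤ n)
    (hW : Integrable W) (hW0 : ∀ t, 0 ≤ W t) (hE : IsOpen E) (hε0 : 0 < ε) (hε : ε ≤ 1 / 64)
    (hEε : volume.real E ≤ ε) (hWM : ∀ t ∈ Eᶜ, Real.exp (-M) ≤ W t) (t : UnitAddCircle) :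
    ‖P.eval (circlePoint t)‖ ^ 2 ≤ (∫ t, ‖P.eval (circlePoint t)‖ ^ 2 * W t) *
      Real.exp (M + Real.log ε⁻¹ + 24 * Real.pi * ε * n) := by
  have hEc := one_half_le_volume_real_compl hE.measurableSet (by linarith)
  have hX : 0 < ∫ t, ‖P.eval (circlePoint t)‖ ^ 2 * W t :=
    integral_norm_sq_eval_mul_pos hP hW hW0 (F := Eᶜ)
      (fun h => by rw [measureReal_def, h, ENNReal.toReal_zero] at hEc; linarith)
      fun t ht => (Real.exp_pos _).trans_le (hWM t ht)
  set f : UnitAddCircle → ℝ := fun t => ‖P.eval (circlePoint t)‖ ^ 2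
  set X := ∫ t, f t * W t
  have hcont : Continuous f := (P.continuous.comp continuous_circlePoint).norm.pow 2
  set A := X * Real.exp M / ε with hA
  have hMarkov : volume.real {t | X / ε ≤ f t * W t} ≤ ε := measureReal_integral_div_le_le
    (Filter.Eventually.of_forall fun t => mul_nonneg (sq_nonneg _) (hW0 t))
    (integrable_norm_sq_eval_mul P hW) hX hε0
  have hlarge : ∀ t ∈ Eᶜ, A < f t → X / ε ≤ f t * W t := fun t htE hAt =>
    calc X / ε = A * Real.exp (-M) := by rw [hA, Real.exp_neg]; field_simp
      _ ≤ f t * W t := mul_le_mul hAt.le (hWM t htE) (Real.exp_pos _).le (sq_nonneg _)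
  have hbad : volume.real (Eᶜ ∩ {t | f t ≤ A})ᶜ ≤ 2 * ε := by
    have hsub : (Eᶜ ∩ {t | f t ≤ A})ᶜ ⊆ E ∪ {t | X / ε ≤ f t * W t} := fun t ht =>
      or_iff_not_imp_left.mpr fun htE => hlarge t htE (not_le.mp fun h => ht ⟨htE, h⟩)
    linarith [(measureReal_mono (μ := volume) hsub).trans (measureReal_union_le _ _)]
  refine (norm_sq_eval_circlePoint_le_mul_exp hn
    (hE.isClosed_compl.inter (isClosed_le hcont continuous_const)) (by linarith) (by linarith)
    hbad (fun t ht => ht.2) t).trans_eq ?_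
  rw [hA, Real.exp_add, Real.exp_add, Real.exp_log (inv_pos.mpr hε0)]
  ring_nf

theorem add_log_inv_add_nonneg (hM : 0 ≤ M) (hε0 : 0 < ε) (hε : ε ≤ 1) (n : ℕ) :
    0 ≤ M + Real.log ε⁻¹ + 24 * Real.pi * ε * n := by
  have hlog : 0 ≤ Real.log ε⁻¹ := Real.log_nonneg ((one_le_inv₀ hε0).mpr hε)
  have := Real.pi_pos
  positivity

theorem log_norm_sq_eval_le (hP : P ≠ 0) (hn : P.natDegree ≤ n) (hW : Integrable W)
    (hW0 : ∀ t, 0 ≤ W t) (hE : IsOpen E) (hε0 : 0 < ε) (hε : ε ≤ 1 / 64) (hEε : volume.real E ≤ ε)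
    (hWM : ∀ t ∈ Eᶜ, Real.exp (-M) ≤ W t) (hM : 0 ≤ M)
    (hX : ∫ t, ‖P.eval (circlePoint t)‖ ^ 2 * W t ≤ 1) (t : UnitAddCircle) :
    Real.log (‖P.eval (circlePoint t)‖ ^ 2) ≤ M + Real.log ε⁻¹ + 24 * Real.pi * ε * n := by
  have hbound := (norm_sq_eval_le_integral_norm_sq_mul hP hn hW hW0 hE hε0 hε hEε hWM t).trans
    (mul_le_of_le_one_left (Real.exp_pos _).le hX)
  rcases (sq_nonneg ‖P.eval (circlePoint t)‖).eq_or_lt with hzero | hpos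
  · rw [← hzero, Real.log_zero]
    exact add_log_inv_add_nonneg hM hε0 (by linarith) n
  · exact (Real.log_le_iff_le_exp hpos).mpr hbound

theorem integrableOn_log_of_exp_neg_le {F : Set UnitAddCircle} (hF : MeasurableSet F)
    (hWm : Measurable W) (hW1 : ∀ t, W t ≤ 1) (hWM : ∀ t ∈ F, Real.exp (-M) ≤ W t) :
    IntegrableOn (fun t => Real.log (W t)) F := by
  refine IntegrableOn.of_bound (measure_lt_top _ _) hWm.log.aestronglyMeasurable M ?_
  filter_upwards [ae_restrict_mem hF] with t ht
  have hpos : 0 < W t := (Real.exp_pos _).trans_le (hWM t ht)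
  rw [Real.norm_of_nonpos (Real.log_nonpos hpos.le (hW1 t)), neg_le]
  exact (Real.le_log_iff_exp_le hpos).mpr (hWM t ht)

/-- Since `P` is monic, `∫ log |P|² ≥ 0` by Jensen's formula. Off `E` the integral of `log |P|²` is
controlled by `∫ |P|² W` and `∫ log W`, and on `E` by the Remez inequality. -/
theorem exp_neg_le_integral_norm_sq_mul (hP : P.Monic) (hn : P.natDegree ≤ n)
    (hWm : Measurable W) (hW0 : ∀ t, 0 ≤ W t) (hW1 : ∀ t, W t ≤ 1) (hE : IsOpen E) (hε0 : 0 < ε)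
    (hε : ε ≤ 1 / 64) (hEε : volume.real E ≤ ε) (hWM : ∀ t ∈ Eᶜ, Real.exp (-M) ≤ W t) (hM : 0 ≤ M) :
    Real.exp (-(2 * (1 - (∫ t in Eᶜ, Real.log (W t)) +
        ε * (M + Real.log ε⁻¹ + 24 * Real.pi * ε * n)))) ≤
      ∫ t, ‖P.eval (circlePoint t)‖ ^ 2 * W t := by
  have hW : Integrable W := .of_bound hWm.aestronglyMeasurable 1
    (Filter.Eventually.of_forall fun t => (Real.norm_of_nonneg (hW0 t)).trans_le (hW1 t))
  have hWpos : ∀ t ∈ Eᶜ, 0 < W t := fun t ht => (Real.exp_pos _).trans_le (hWM t ht)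
  have hEc := one_half_le_volume_real_compl hE.measurableSet (by linarith)
  have hX := integral_norm_sq_eval_mul_pos hP.ne_zero hW hW0 (F := Eᶜ)
    (fun h => by rw [measureReal_def, h, ENNReal.toReal_zero] at hEc; linarith) hWpos
  have hrest := add_log_inv_add_nonneg hM hε0 (by linarith) n
  set R := M + Real.log ε⁻¹ + 24 * Real.pi * ε * n
  set X := ∫ t, ‖P.eval (circlePoint t)‖ ^ 2 * W t
  rcases le_total 1 X with h1X | hX1
  · refine le_trans (Real.exp_le_one_iff.mpr ?_) h1X
    have hlogW : ∫ t in Eᶜ, Real.log (W t) ≤ 0 :=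
      integral_nonpos fun t => Real.log_nonpos (hW0 t) (hW1 t)
    linarith [mul_nonneg hε0.le hrest]
  have hon : ∫ t in E, Real.log (‖P.eval (circlePoint t)‖ ^ 2) ≤ volume.real E * R :=
    (setIntegral_mono (integrable_log_norm_sq_eval P).integrableOn integrableOn_const
      (log_norm_sq_eval_le hP.ne_zero hn hW hW0 hE hε0 hε hEε hWM hM hX1)).trans_eq
      (setIntegral_const _)
  have hoff := integral_log_le_of_integral_mul_le
    ((ae_restrict_of_ae (ae_eval_circlePoint_ne_zero hP.ne_zero)).mono fun t ht => by positivity)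
    (ae_restrict_of_forall_mem hE.measurableSet.compl hWpos)
    (integrable_log_norm_sq_eval P).integrableOn
    (integrableOn_log_of_exp_neg_le hE.measurableSet.compl hWm hW1 hWM)
    (integrable_norm_sq_eval_mul P hW).integrableOn hX
    (setIntegral_le_integral (integrable_norm_sq_eval_mul P hW)
      (Filter.Eventually.of_forall fun t => mul_nonneg (sq_nonneg _) (hW0 t)))
  rw [measureReal_restrict_apply_univ] at hoff
  have hJensen := integral_log_norm_sq_eval_nonneg hP
  rw [← integral_add_compl hE.measurableSet (integrable_log_norm_sq_eval P)] at hJensen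
  have hlogX : volume.real Eᶜ * Real.log X ≤ 1 / 2 * Real.log X :=
    mul_le_mul_of_nonpos_right hEc (Real.log_nonpos hX.le hX1)
  rw [← Real.le_log_iff_exp_le hX]
  linarith [mul_le_mul_of_nonneg_right hEε hrest]

end SzegoLowerBound

section DistanceIntegral

open Metric

variable {X : Type*} [PseudoMetricSpace X] {K : Set X} {p δ : ℝ}

theorem le_infDist_of_mem_compl_thickening (hK : K.Nonempty) {t : X} (ht : t ∈ (thickening δ K)ᶜ) :
    δ ≤ infDist t K :=
  not_lt.mp fun h => ht ((mem_thickening_iff_infDist_lt hK).mpr h)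

theorem infDist_rpow_neg_le_of_mem_compl_thickening (hK : K.Nonempty) (hp : 0 ≤ p) (hδ : 0 < δ)
    {t : X} (ht : t ∈ (thickening δ K)ᶜ) : infDist t K ^ (-p) ≤ δ ^ (-p) :=
  Real.rpow_le_rpow_of_nonpos hδ (le_infDist_of_mem_compl_thickening hK ht) (neg_nonpos.mpr hp)

theorem infDist_lt_rpow_of_lt_rpow_neg (hp : 0 < p) {s : ℝ} (hs : 0 < s) {t : X}
    (h : s < infDist t K ^ (-p)) : infDist t K < s ^ (-p⁻¹) := by
  rcases (infDist_nonneg (x := t) (s := K)).eq_or_lt with hzero | hpos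
  · rw [← hzero]
    positivity
  · calc infDist t K = (infDist t K ^ (-p)) ^ (-p⁻¹) := by
          rw [← Real.rpow_mul hpos.le, neg_mul_neg, mul_inv_cancel₀ hp.ne', Real.rpow_one]
      _ < s ^ (-p⁻¹) := Real.rpow_lt_rpow_of_neg hs h (by simpa using hp)

variable [MeasurableSpace X] {μ : Measure X} [IsFiniteMeasure μ]

theorem measureReal_lt_infDist_rpow_neg_le {θ B s : ℝ} (hK : K.Nonempty) (hp : 0 < p)
    (hB : ∀ r > 0, μ.real (thickening r K) ≤ B * r ^ θ) (hs : 0 < s) :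
    μ.real {t | s < infDist t K ^ (-p)} ≤ B * s ^ (-θ / p) :=
  calc μ.real {t | s < infDist t K ^ (-p)} ≤ μ.real (thickening (s ^ (-p⁻¹)) K) :=
        measureReal_mono fun _ ht => (mem_thickening_iff_infDist_lt hK).mpr
          (infDist_lt_rpow_of_lt_rpow_neg hp hs ht)
    _ ≤ B * (s ^ (-p⁻¹)) ^ θ := hB _ (Real.rpow_pos_of_pos hs _)
    _ = B * s ^ (-θ / p) := by rw [← Real.rpow_mul hs.le]; ring_nf

variable [OpensMeasurableSpace X]

theorem integrableOn_infDist_rpow_neg (hK : K.Nonempty) (hp : 0 ≤ p) (hδ : 0 < δ) :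
    IntegrableOn (fun t => infDist t K ^ (-p)) (thickening δ K)ᶜ μ := by
  refine Measure.integrableOn_of_bounded (M := δ ^ (-p)) (measure_ne_top _ _)
    ((continuous_infDist_pt K).measurable.pow_const _).aestronglyMeasurable ?_
  filter_upwards [ae_restrict_mem isOpen_thickening.measurableSet.compl] with t ht
  rw [Real.norm_of_nonneg (Real.rpow_nonneg infDist_nonneg _)]
  exact infDist_rpow_neg_le_of_mem_compl_thickening hK hp hδ ht

theorem setIntegral_infDist_rpow_neg_le {θ B : ℝ} (hK : K.Nonempty) (hp : 0 < p) (hθp : θ < p)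
    (hB : ∀ r > 0, μ.real (thickening r K) ≤ B * r ^ θ) (hδ : 0 < δ) :
    ∫ t in (thickening δ K)ᶜ, infDist t K ^ (-p) ∂μ ≤ B * p / (p - θ) * δ ^ (θ - p) := by
  set μδ := μ.restrict (thickening δ K)ᶜ
  have hae : ∀ᵐ t ∂μδ, t ∈ (thickening δ K)ᶜ :=
    ae_restrict_mem isOpen_thickening.measurableSet.compl
  have hlevel : ∀ s ∈ Set.Ioc 0 (δ ^ (-p)),
      μδ.real {t | s < infDist t K ^ (-p)} ≤ B * s ^ (-θ / p) := fun s hs =>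
    (ENNReal.toReal_mono (measure_ne_top _ _) (Measure.restrict_apply_le _ _)).trans
      (measureReal_lt_infDist_rpow_neg_le hK hp hB hs.1)
  have hexp : -1 < -θ / p := by rw [lt_div_iff₀ hp]; linarith
  calc ∫ t, infDist t K ^ (-p) ∂μδ
      = ∫ s in Set.Ioi 0, μδ.real {t | s < infDist t K ^ (-p)} :=
        (integrableOn_infDist_rpow_neg hK hp.le hδ).integral_eq_integral_meas_lt
          (Filter.Eventually.of_forall fun t => Real.rpow_nonneg infDist_nonneg _)
    _ = ∫ s in Set.Ioc 0 (δ ^ (-p)), μδ.real {t | s < infDist t K ^ (-p)} := by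
        refine setIntegral_eq_of_subset_of_forall_sdiff_eq_zero measurableSet_Ioi
          Set.Ioc_subset_Ioi_self fun s hs => ?_
        rw [measureReal_eq_zero_iff, measure_eq_zero_iff_ae_notMem]
        filter_upwards [hae] with t ht hst
        exact hs.2 ⟨hs.1, hst.le.trans (infDist_rpow_neg_le_of_mem_compl_thickening hK hp.le hδ ht)⟩
    _ ≤ ∫ s in Set.Ioc 0 (δ ^ (-p)), B * s ^ (-θ / p) := by
        refine integral_mono_of_nonneg (Filter.Eventually.of_forall fun s => measureReal_nonneg)
          ?_ ((ae_restrict_iff' measurableSet_Ioc).mpr (Filter.Eventually.of_forall hlevel))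
        exact ((intervalIntegral.intervalIntegrable_rpow' hexp).const_mul B).1
    _ = B * (δ ^ (-p)) ^ (-θ / p + 1) / (-θ / p + 1) := by
        rw [← intervalIntegral.integral_of_le (by positivity), intervalIntegral.integral_const_mul,
          integral_rpow (Or.inl hexp), Real.zero_rpow (by linarith), sub_zero, mul_div_assoc]
    _ = B * p / (p - θ) * δ ^ (θ - p) := by
        rw [← Real.rpow_mul hδ.le]
        have hsub : p - θ ≠ 0 := by linarith
        have hadd : -θ / p + 1 = (p - θ) / p := by field_simp; ring
        rw [hadd]
        field_simp
        congr 2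
        ring

end DistanceIntegral

section PredictionError

open Metric Polynomial

theorem predictionError_le_sqrt {n : ℕ} {Q : ℂ[X]} (hQ : Q.Monic) (hn : Q.natDegree = n)
    (ρ : Measure UnitAddCircle) :
    predictionError ρ n ≤ Real.sqrt (∫ t, ‖Q.eval (circlePoint t)‖ ^ 2 ∂ρ) := by
  have heval (z : ℂ) : Q.eval z = (∑ j : Fin n, Q.coeff j * z ^ (j : ℕ)) + z ^ n := by
    rw [eval_eq_sum_range, hn, Finset.sum_range_succ,
      Fin.sum_univ_eq_sum_range (fun j => Q.coeff j * z ^ j) n, ← hn, coeff_natDegree,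
      hQ.leadingCoeff, one_mul]
  simp only [heval]
  exact ciInf_le ⟨0, Set.forall_mem_range.mpr fun _ => Real.sqrt_nonneg _⟩
    fun j : Fin n => Q.coeff j

theorem le_predictionError {n : ℕ} {ρ : Measure UnitAddCircle} {a : ℝ}
    (h : ∀ Q : ℂ[X], Q.Monic → Q.natDegree = n →
      a ≤ Real.sqrt (∫ t, ‖Q.eval (circlePoint t)‖ ^ 2 ∂ρ)) :
    a ≤ predictionError ρ n := by
  refine le_ciInf fun q => ?_
  have hdeg := degree_sum_fin_lt q
  have hle := h (X ^ n + ∑ j : Fin n, C (q j) * X ^ (j : ℕ)) (monic_X_pow_add hdeg)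
    (natDegree_eq_of_degree_eq_some (by rw [degree_add_eq_left_of_degree_lt (by rwa [degree_X_pow]),
      degree_X_pow]))
  simpa only [eval_add, eval_pow, eval_X, eval_finsetSum, eval_mul, eval_C, add_comm] using hle

variable {K : Set UnitAddCircle} {p δ r : ℝ} {t : UnitAddCircle}

variable (K p) in
theorem deepZeroDensity_nonneg (t : UnitAddCircle) : 0 ≤ deepZeroDensity K p t := by
  rw [deepZeroDensity]
  split_ifs <;> positivity

theorem deepZeroDensity_le_exp (hp : 0 ≤ p) (ht : infDist t K ≤ r) :
    deepZeroDensity K p t ≤ Real.exp (-r ^ (-p)) := by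
  rw [deepZeroDensity]
  split_ifs with h
  · positivity
  · exact Real.exp_le_exp.mpr (neg_le_neg (Real.rpow_le_rpow_of_nonpos
      (infDist_nonneg.lt_of_ne (Ne.symm h)) ht (neg_nonpos.mpr hp)))

variable (K p) in
theorem deepZeroDensity_le_one (t : UnitAddCircle) : deepZeroDensity K p t ≤ 1 := by
  rw [deepZeroDensity]
  split_ifs
  · exact zero_le_one
  · exact Real.exp_le_one_iff.mpr (neg_nonpos.mpr (Real.rpow_nonneg infDist_nonneg _))

theorem deepZeroDensity_eq_exp (hK : K.Nonempty) (hδ : 0 < δ) (ht : t ∈ (thickening δ K)ᶜ) :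
    deepZeroDensity K p t = Real.exp (-infDist t K ^ (-p)) :=
  if_neg (hδ.trans_le (le_infDist_of_mem_compl_thickening hK ht)).ne'

variable (K p) in
theorem measurable_deepZeroDensity : Measurable (deepZeroDensity K p) :=
  have hdist : Continuous fun t => infDist t K := continuous_infDist_pt K
  Measurable.ite (isClosed_eq hdist continuous_const).measurableSet measurable_const
    (hdist.measurable.pow_const _).neg.exp

theorem integral_deepZeroMeasure (f : UnitAddCircle → ℝ) :
    ∫ t, f t ∂(deepZeroMeasure K p) = ∫ t, f t * deepZeroDensity K p t := by
  rw [deepZeroMeasure, integral_withDensity_eq_integral_toReal_smul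
    (measurable_deepZeroDensity K p).ennreal_ofReal (by simp)]
  simp only [ENNReal.toReal_ofReal (deepZeroDensity_nonneg K p _), smul_eq_mul, mul_comm]

theorem exp_neg_le_predictionError {n : ℕ} {ε : ℝ} (hK : K.Nonempty) (hp : 0 ≤ p) (hδ : 0 < δ)
    (hε0 : 0 < ε) (hε : ε ≤ 1 / 64) (hKε : volume.real (thickening δ K) ≤ ε) :
    Real.exp (-(1 + ∫ t in (thickening δ K)ᶜ, infDist t K ^ (-p)) -
      ε * (δ ^ (-p) + Real.log ε⁻¹ + 24 * Real.pi * ε * n)) ≤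
      predictionError (deepZeroMeasure K p) n := by
  have hdensity : ∀ t ∈ (thickening δ K)ᶜ, Real.exp (-δ ^ (-p)) ≤ deepZeroDensity K p t :=
    fun t ht => by
      rw [deepZeroDensity_eq_exp hK hδ ht]
      exact Real.exp_le_exp.mpr
        (neg_le_neg (infDist_rpow_neg_le_of_mem_compl_thickening hK hp hδ ht))
  have hlog : ∫ t in (thickening δ K)ᶜ, Real.log (deepZeroDensity K p t) =
      -∫ t in (thickening δ K)ᶜ, infDist t K ^ (-p) := by
    rw [← integral_neg]
    refine setIntegral_congr_fun isOpen_thickening.measurableSet.compl fun t ht => ?_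
    simp only [deepZeroDensity_eq_exp hK hδ ht, Real.log_exp]
  refine le_predictionError fun Q hQ hQn => Real.le_sqrt_of_sq_le ?_
  rw [integral_deepZeroMeasure, ← Real.exp_nat_mul]
  refine le_trans (le_of_eq ?_) (exp_neg_le_integral_norm_sq_mul hQ hQn.le
    (measurable_deepZeroDensity K p) (deepZeroDensity_nonneg K p) (deepZeroDensity_le_one K p)
    isOpen_thickening hε0 hε hKε hdensity (Real.rpow_nonneg hδ.le _))
  rw [hlog]
  push_cast
  ring_nf

end PredictionError

section ArcChebyshev

open Polynomial Polynomial.Chebyshev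

theorem card_roots_T_real (N : ℕ) : (T ℝ N).roots.card = N := by
  rw [roots_T_real, Finset.card_val,
    Finset.card_image_of_injOn ((Finset.range N).nodup_map_iff_injOn.mp (roots_T_real_nodup N)),
    Finset.card_range]

theorem eval_T_eq_two_pow_mul_prod_roots (N : ℕ) (y : ℝ) :
    (T ℝ N).eval y = 2 ^ (N - 1) * ((T ℝ N).roots.map (y - ·)).prod := by
  have hsplits : (T ℝ N).Splits := splits_iff_card_roots.mpr (by
    rw [card_roots_T_real, natDegree_T, Int.natAbs_natCast])
  rw [hsplits.eval_eq_prod_roots, leadingCoeff_T, Int.natAbs_natCast]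

/-- The monic quadratic polynomial with zeros at the two points `w * exp (± i φ)` for which
`(1 + cos φ) / s ^ 2 - 1 = x`. -/
noncomputable def arcQuadratic (w : ℂ) (s x : ℝ) : ℂ[X] :=
  X ^ 2 + C (2 * w - (2 * s ^ 2 * (1 + x) : ℝ) * w) * X + C (w ^ 2)

theorem natDegree_arcQuadratic (w : ℂ) (s x : ℝ) : (arcQuadratic w s x).natDegree = 2 := by
  rw [arcQuadratic]
  compute_degree!

theorem monic_arcQuadratic (w : ℂ) (s x : ℝ) : (arcQuadratic w s x).Monic := by
  rw [arcQuadratic]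
  monicity!

theorem norm_eval_arcQuadratic {w : ℂ} (hw : ‖w‖ = 1) {s : ℝ} (hs : 0 < s) (x φ : ℝ) :
    ‖(arcQuadratic w s x).eval (w * Complex.exp (φ * Complex.I))‖ =
      2 * s ^ 2 * |(1 + Real.cos φ) / s ^ 2 - 1 - x| := by
  set z := Complex.exp (φ * Complex.I) with hz
  have hcos : (2 * Real.cos φ : ℝ) * z = z ^ 2 + 1 := by
    push_cast
    rw [Complex.two_cos, add_mul, neg_mul, Complex.exp_neg, ← hz,
      inv_mul_cancel₀ (Complex.exp_ne_zero _), sq]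
  have haffine : 2 * s ^ 2 * ((1 + Real.cos φ) / s ^ 2 - 1 - x) =
      2 + 2 * Real.cos φ - 2 * s ^ 2 * (1 + x) := by
    field_simp
    ring
  have heval : (arcQuadratic w s x).eval (w * z) =
      w ^ 2 * z * ((2 * s ^ 2 * ((1 + Real.cos φ) / s ^ 2 - 1 - x) : ℝ) : ℂ) := by
    rw [haffine, arcQuadratic, Complex.ofReal_sub, Complex.ofReal_add, Complex.ofReal_ofNat]
    simp only [eval_add, eval_pow, eval_X, eval_mul, eval_C]
    linear_combination (-w ^ 2) * hcos
  rw [heval, norm_mul, norm_mul, norm_pow, hw, Complex.norm_exp_ofReal_mul_I, Complex.norm_real,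
    Real.norm_eq_abs, abs_mul, abs_of_pos (by positivity : 0 < 2 * s ^ 2)]
  ring

/-- The monic polynomial of degree `2 * N` whose zeros lie over those of the Chebyshev polynomial
`T_N`. For `s = cos (a / 2)` it is adapted to the arc of the points `w * exp (i φ)` with
`cos φ ≤ cos a`, the complement of the arc of half-angle `a` about `w`. -/
noncomputable def arcChebyshev (w : ℂ) (s : ℝ) (N : ℕ) : ℂ[X] :=
  ((T ℝ N).roots.map (arcQuadratic w s)).prod

theorem monic_arcChebyshev (w : ℂ) (s : ℝ) (N : ℕ) : (arcChebyshev w s N).Monic :=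
  monic_multiset_prod_of_monic _ _ fun x _ => monic_arcQuadratic w s x

theorem natDegree_arcChebyshev (w : ℂ) (s : ℝ) (N : ℕ) :
    (arcChebyshev w s N).natDegree = 2 * N := by
  have hmonic : ∀ f ∈ (T ℝ N).roots.map (arcQuadratic w s), f.Monic := by
    simp only [Multiset.mem_map]
    rintro _ ⟨x, -, rfl⟩
    exact monic_arcQuadratic w s x
  rw [arcChebyshev, natDegree_multiset_prod_of_monic _ hmonic, Multiset.map_map]
  simp only [Function.comp_def, natDegree_arcQuadratic, Multiset.map_const',
    Multiset.sum_replicate, card_roots_T_real, smul_eq_mul, mul_comm]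

theorem norm_eval_arcChebyshev_le {w : ℂ} (hw : ‖w‖ = 1) {s : ℝ} (hs : 0 < s) (N : ℕ) (φ : ℝ) :
    ‖(arcChebyshev w s N).eval (w * Complex.exp (φ * Complex.I))‖ ≤
      2 * (s ^ (2 * N) * |(T ℝ N).eval ((1 + Real.cos φ) / s ^ 2 - 1)|) := by
  set y := (1 + Real.cos φ) / s ^ 2 - 1
  have htwo : (2 : ℝ) ^ N ≤ 2 * 2 ^ (N - 1) := by
    rw [← pow_succ']
    exact pow_le_pow_right₀ one_le_two (by omega)
  have habs : |((T ℝ N).roots.map (y - ·)).prod| = ((T ℝ N).roots.map fun x => |y - x|).prod :=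
    (map_multiset_prod (absHom : ℝ →*₀ ℝ) _).trans (by rw [Multiset.map_map]; rfl)
  calc ‖(arcChebyshev w s N).eval (w * Complex.exp (φ * Complex.I))‖
      = ((T ℝ N).roots.map fun x => 2 * s ^ 2 * |y - x|).prod := by
        rw [arcChebyshev, eval_multiset_prod, ← normHom_apply, map_multiset_prod, Multiset.map_map,
          Multiset.map_map]
        exact congrArg _ (Multiset.map_congr rfl fun x _ => norm_eval_arcQuadratic hw hs x φ)
    _ = 2 ^ N * (s ^ (2 * N) * |((T ℝ N).roots.map (y - ·)).prod|) := by
        rw [Multiset.prod_map_mul, Multiset.map_const', Multiset.prod_replicate,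
          card_roots_T_real, habs, mul_pow, ← pow_mul, mul_assoc]
    _ ≤ 2 * 2 ^ (N - 1) * (s ^ (2 * N) * |((T ℝ N).roots.map (y - ·)).prod|) := by gcongr
    _ = 2 * (s ^ (2 * N) * |(T ℝ N).eval y|) := by
        rw [eval_T_eq_two_pow_mul_prod_roots, abs_mul, abs_pow, Nat.abs_ofNat]
        ring

theorem monotoneOn_eval_T (N : ℕ) : MonotoneOn (fun y => (T ℝ N).eval y) (Set.Ici 1) := by
  intro y hy z hz hyz
  dsimp only
  rw [← Real.cosh_arcosh hy, ← Real.cosh_arcosh hz, T_real_cosh, T_real_cosh, Int.cast_natCast,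
    Real.cosh_le_cosh, abs_of_nonneg (mul_nonneg N.cast_nonneg (Real.arcosh_nonneg hy)),
    abs_of_nonneg (mul_nonneg N.cast_nonneg (Real.arcosh_nonneg hz))]
  have := (Real.arcosh_le_arcosh (zero_lt_one.trans_le hy) (zero_lt_one.trans_le hz)).mpr hyz
  gcongr

theorem pow_mul_abs_eval_T_le {s σ c : ℝ} (N : ℕ) (hs : 0 < s) (hσ : 0 ≤ σ)
    (hsσ : s ^ 2 + σ ^ 2 = 1) (hc : -1 ≤ c) (hc1 : c ≤ 1) :
    s ^ (2 * N) * |(T ℝ N).eval ((1 + c) / s ^ 2 - 1)| ≤ (1 + σ) ^ (2 * N) := by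
  set y := (1 + c) / s ^ 2 - 1 with hy
  have hy1 : -1 ≤ y := by
    have : 0 ≤ (1 + c) / s ^ 2 := div_nonneg (by linarith) (by positivity)
    linarith
  rw [pow_mul, pow_mul]
  rcases le_total y 1 with h | h
  · calc (s ^ 2) ^ N * |(T ℝ N).eval y| ≤ 1 * 1 :=
          mul_le_mul (pow_le_one₀ (by positivity) (by nlinarith))
            (abs_eval_T_real_le_one N (abs_le.mpr ⟨hy1, h⟩)) (abs_nonneg _) zero_le_one
      _ ≤ ((1 + σ) ^ 2) ^ N := by rw [one_mul]; exact one_le_pow₀ (by nlinarith)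
  · set x := (1 + σ) ^ 2 / s ^ 2 with hx
    have hx1 : 1 ≤ x := by rw [hx, one_le_div (by positivity)]; nlinarith
    have hyx : y ≤ (x + x⁻¹) / 2 :=
      calc y ≤ 2 / s ^ 2 - 1 := by rw [hy]; gcongr; linarith
        _ = (x + x⁻¹) / 2 := by
          have hs2 : s ^ 2 = (1 - σ) * (1 + σ) := by linear_combination hsσ
          have hσ1 : 0 < 1 - σ := by nlinarith [pow_pos hs 2]
          rw [hx, hs2]
          field_simp
          ring
    calc (s ^ 2) ^ N * |(T ℝ N).eval y| = (s ^ 2) ^ N * (T ℝ N).eval y := by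
          rw [abs_of_nonneg (zero_le_one.trans (one_le_eval_T_real N h))]
      _ ≤ (s ^ 2) ^ N * x ^ N := by
          gcongr
          exact (monotoneOn_eval_T N h (h.trans hyx) hyx).trans (eval_T_half_add_inv_le_pow N hx1)
      _ = ((1 + σ) ^ 2) ^ N := by rw [← mul_pow, mul_div_cancel₀ _ (by positivity)]

variable {w : ℂ} {ε : ℝ}

theorem norm_sq_eval_arcChebyshev_le_exp (hw : ‖w‖ = 1) (hε0 : 0 < ε) (hε : ε < 1) (N : ℕ)
    (φ : ℝ) :
    ‖(arcChebyshev w (Real.cos (Real.pi * ε / 2)) N).eval (w * Complex.exp (φ * Complex.I))‖ ^ 2 ≤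
      4 * Real.exp (Real.pi * ε * (2 * N)) := by
  have hangle : 0 < Real.pi * ε / 2 := by positivity
  have hangle' : Real.pi * ε / 2 < Real.pi / 2 := by nlinarith [Real.pi_pos]
  have hs : 0 < Real.cos (Real.pi * ε / 2) :=
    Real.cos_pos_of_mem_Ioo ⟨by linarith, hangle'⟩
  have hsin : 1 + Real.sin (Real.pi * ε / 2) ≤ Real.exp (Real.pi * ε / 2) := by
    linarith [Real.sin_le hangle.le, Real.add_one_le_exp (Real.pi * ε / 2)]
  have hsin0 : 0 ≤ Real.sin (Real.pi * ε / 2) :=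
    Real.sin_nonneg_of_nonneg_of_le_pi hangle.le (by linarith)
  calc ‖(arcChebyshev w (Real.cos (Real.pi * ε / 2)) N).eval
        (w * Complex.exp (φ * Complex.I))‖ ^ 2
      ≤ (2 * (1 + Real.sin (Real.pi * ε / 2)) ^ (2 * N)) ^ 2 := by
        gcongr
        exact (norm_eval_arcChebyshev_le hw hs N φ).trans (mul_le_mul_of_nonneg_left
          (pow_mul_abs_eval_T_le N hs hsin0 (Real.cos_sq_add_sin_sq _) (Real.neg_one_le_cos φ)
            (Real.cos_le_one φ)) zero_le_two)
    _ ≤ (2 * Real.exp (Real.pi * ε / 2) ^ (2 * N)) ^ 2 := by gcongr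
    _ = 4 * Real.exp (Real.pi * ε * (2 * N)) := by
        rw [mul_pow, ← pow_mul, ← Real.exp_nat_mul]
        push_cast
        ring_nf

theorem norm_sq_eval_arcChebyshev_le_exp_neg (hw : ‖w‖ = 1) (hε0 : 0 < ε) (hε : ε < 1) (N : ℕ)
    {φ : ℝ} (hφ : Real.cos φ ≤ Real.cos (Real.pi * ε)) :
    ‖(arcChebyshev w (Real.cos (Real.pi * ε / 2)) N).eval (w * Complex.exp (φ * Complex.I))‖ ^ 2 ≤
      4 * Real.exp (-(2 * N * ε ^ 2)) := by
  have hs : 0 < Real.cos (Real.pi * ε / 2) :=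
    Real.cos_pos_of_mem_Ioo ⟨by nlinarith [Real.pi_pos], by nlinarith [Real.pi_pos]⟩
  have hsin : ε ≤ Real.sin (Real.pi * ε / 2) :=
    calc ε = 2 / Real.pi * (Real.pi * ε / 2) := by field_simp
      _ ≤ _ := Real.mul_le_sin (by positivity) (by nlinarith [Real.pi_pos])
  have hdouble := Real.cos_two_mul (Real.pi * ε / 2)
  rw [mul_div_cancel₀ _ two_ne_zero] at hdouble
  set s := Real.cos (Real.pi * ε / 2)
  have hT : |(T ℝ N).eval ((1 + Real.cos φ) / s ^ 2 - 1)| ≤ 1 := by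
    have hnonneg : 0 ≤ (1 + Real.cos φ) / s ^ 2 :=
      div_nonneg (by linarith [Real.neg_one_le_cos φ]) (by positivity)
    have hle : (1 + Real.cos φ) / s ^ 2 ≤ 2 := by
      rw [div_le_iff₀ (by positivity)]
      linarith
    exact abs_eval_T_real_le_one N (abs_le.mpr ⟨by linarith, by linarith⟩)
  have hs_exp : s ^ 2 ≤ Real.exp (-ε ^ 2) := by
    nlinarith [Real.cos_sq_add_sin_sq (Real.pi * ε / 2), Real.add_one_le_exp (-ε ^ 2)]
  calc ‖(arcChebyshev w s N).eval (w * Complex.exp (φ * Complex.I))‖ ^ 2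
      ≤ (2 * (s ^ (2 * N) * 1)) ^ 2 := by
        gcongr
        exact (norm_eval_arcChebyshev_le hw hs N φ).trans (by gcongr)
    _ = 4 * (s ^ 2) ^ (2 * N) := by ring
    _ ≤ 4 * Real.exp (-ε ^ 2) ^ (2 * N) := by gcongr
    _ = 4 * Real.exp (-(2 * N * ε ^ 2)) := by
        rw [← Real.exp_nat_mul]
        push_cast
        ring_nf

theorem exists_coe_eq_and_abs_eq_norm (t : UnitAddCircle) :
    ∃ x : ℝ, (x : UnitAddCircle) = t ∧ |x| = ‖t‖ := by
  obtain ⟨x, rfl⟩ := QuotientAddGroup.mk_surjective t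
  refine ⟨x - round x, ?_, UnitAddCircle.norm_eq.symm⟩
  rw [AddCircle.coe_sub]
  exact sub_eq_self.mpr ((AddCircle.coe_eq_zero_iff 1).mpr ⟨round x, by simp⟩)

theorem exists_circlePoint_eq_mul_exp (t₀ t : UnitAddCircle) : ∃ φ : ℝ, |φ| ≤ Real.pi ∧
    2 * Real.pi * dist t t₀ = |φ| ∧
    circlePoint t = circlePoint t₀ * Complex.exp (φ * Complex.I) := by
  obtain ⟨x, hx, hnorm⟩ := exists_coe_eq_and_abs_eq_norm (t - t₀)
  have habs : |2 * Real.pi * x| = 2 * Real.pi * dist t t₀ := by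
    rw [abs_mul, abs_of_pos Real.two_pi_pos, hnorm, dist_eq_norm]
  have hhalf : dist t t₀ ≤ 1 / 2 := by
    simpa only [dist_eq_norm, abs_one] using AddCircle.norm_le_half_period 1 one_ne_zero
  refine ⟨2 * Real.pi * x, ?_, habs.symm, ?_⟩
  · rw [habs]
    nlinarith [Real.pi_pos]
  · rw [← circlePoint_coe, hx, ← circlePoint_add, add_sub_cancel]

theorem exists_monic_norm_sq_eval_le (t₀ : UnitAddCircle) (hε0 : 0 < ε) (hε : ε < 1) (n : ℕ) :
    ∃ Q : ℂ[X], Q.Monic ∧ Q.natDegree = n ∧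
      (∀ t, ‖Q.eval (circlePoint t)‖ ^ 2 ≤ 4 * Real.exp (Real.pi * n * ε)) ∧
      ∀ t ∉ Metric.closedBall t₀ (ε / 2),
        ‖Q.eval (circlePoint t)‖ ^ 2 ≤ 12 * Real.exp (-(n * ε ^ 2)) := by
  set N := n / 2
  have hN : 2 * N + n % 2 = n := Nat.div_add_mod n 2
  have hle : 2 * (N : ℝ) ≤ n := by exact_mod_cast (by omega : 2 * N ≤ n)
  have hge : (n : ℝ) ≤ 2 * N + 1 := by exact_mod_cast (by omega : n ≤ 2 * N + 1)
  have hw := norm_circlePoint t₀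
  have hmonic := monic_arcChebyshev (circlePoint t₀) (Real.cos (Real.pi * ε / 2)) N
  refine ⟨arcChebyshev (circlePoint t₀) (Real.cos (Real.pi * ε / 2)) N * X ^ (n % 2),
    hmonic.mul (monic_X_pow _), ?_, fun t => ?_, fun t ht => ?_⟩
  · rw [hmonic.natDegree_mul (monic_X_pow _), natDegree_arcChebyshev, natDegree_X_pow, hN]
  all_goals
    obtain ⟨φ, hφ, hdist, hpoint⟩ := exists_circlePoint_eq_mul_exp t₀ t
    rw [eval_mul, eval_pow, eval_X, norm_mul, norm_pow, norm_circlePoint, one_pow, mul_one, hpoint]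
  · refine (norm_sq_eval_arcChebyshev_le_exp hw hε0 hε N φ).trans ?_
    rw [mul_right_comm]
    gcongr
  · have hcos : Real.cos φ ≤ Real.cos (Real.pi * ε) := by
      rw [Metric.mem_closedBall, not_le] at ht
      rw [← Real.cos_abs φ]
      exact Real.cos_le_cos_of_nonneg_of_le_pi (by positivity) hφ
        (by nlinarith [Real.pi_pos])
    calc _ ≤ 4 * Real.exp (-(2 * N * ε ^ 2)) :=
          norm_sq_eval_arcChebyshev_le_exp_neg hw hε0 hε N hcos
      _ ≤ 4 * Real.exp (1 + -(n * ε ^ 2)) := by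
          gcongr
          nlinarith
      _ ≤ 12 * Real.exp (-(n * ε ^ 2)) := by
          rw [Real.exp_add]
          nlinarith [Real.exp_pos (-(n * ε ^ 2)), Real.exp_one_lt_d9]

end ArcChebyshev

section UpperBound

open Metric Polynomial

variable {K : Set UnitAddCircle} {p : ℝ} {n : ℕ}

theorem predictionError_le_sqrt_of_forall_le {Q : ℂ[X]} {A : ℝ} (hQ : Q.Monic)
    (hn : Q.natDegree = n) (hA : ∀ t, ‖Q.eval (circlePoint t)‖ ^ 2 * deepZeroDensity K p t ≤ A) :
    predictionError (deepZeroMeasure K p) n ≤ Real.sqrt A := by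
  refine (predictionError_le_sqrt hQ hn _).trans (Real.sqrt_le_sqrt ?_)
  rw [integral_deepZeroMeasure]
  calc ∫ t, ‖Q.eval (circlePoint t)‖ ^ 2 * deepZeroDensity K p t ≤ ∫ _ : UnitAddCircle, A :=
        integral_mono_of_nonneg (Filter.Eventually.of_forall fun t =>
          mul_nonneg (by positivity) (deepZeroDensity_nonneg K p t)) (integrable_const A)
          (Filter.Eventually.of_forall hA)
    _ = A := by rw [integral_const, probReal_univ, one_smul]

theorem infDist_le_half (K : Set UnitAddCircle) (t : UnitAddCircle) : infDist t K ≤ 1 / 2 := by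
  rcases K.eq_empty_or_nonempty with rfl | ⟨s, hs⟩
  · rw [infDist_empty]
    norm_num
  · refine (infDist_le_dist_of_mem hs).trans ?_
    simpa only [dist_eq_norm, abs_one] using AddCircle.norm_le_half_period 1 one_ne_zero

theorem predictionError_le_exp_neg_half (hp : 0 ≤ p) (n : ℕ) :
    predictionError (deepZeroMeasure K p) n ≤ Real.exp (-(1 / 2)) := by
  have hpow : (1 : ℝ) ≤ (1 / 2) ^ (-p) :=
    Real.one_le_rpow_of_pos_of_le_one_of_nonpos one_half_pos (by norm_num) (neg_nonpos.mpr hp)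
  have hle := predictionError_le_sqrt_of_forall_le (K := K) (p := p) (A := Real.exp (-1))
    (monic_X_pow (R := ℂ) n) (natDegree_X_pow n) fun t => by
      rw [eval_pow, eval_X, norm_pow, norm_circlePoint, one_pow, one_pow, one_mul]
      exact (deepZeroDensity_le_exp hp (infDist_le_half K t)).trans
        (Real.exp_le_exp.mpr (neg_le_neg hpow))
  rwa [← Real.exp_half, neg_div] at hle

theorem predictionError_le_sqrt_of_infDist_le {t₀ : UnitAddCircle} {ε r : ℝ} (hp : 0 ≤ p)
    (hε : ε ∈ Set.Ioo 0 1) (hr : ∀ t ∈ closedBall t₀ (ε / 2), infDist t K ≤ r) :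
    predictionError (deepZeroMeasure K p) n ≤ Real.sqrt
      (12 * Real.exp (-(n * ε ^ 2)) + 4 * Real.exp (Real.pi * n * ε - r ^ (-p))) := by
  obtain ⟨Q, hQ, hn, hQ_on, hQ_off⟩ := exists_monic_norm_sq_eval_le t₀ hε.1 hε.2 n
  refine predictionError_le_sqrt_of_forall_le hQ hn fun t => ?_
  by_cases ht : t ∈ closedBall t₀ (ε / 2)
  · calc ‖Q.eval (circlePoint t)‖ ^ 2 * deepZeroDensity K p t
        ≤ 4 * Real.exp (Real.pi * n * ε) * Real.exp (-r ^ (-p)) :=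
          mul_le_mul (hQ_on t) (deepZeroDensity_le_exp hp (hr t ht)) (deepZeroDensity_nonneg K p t)
            (by positivity)
      _ = 4 * Real.exp (Real.pi * n * ε - r ^ (-p)) := by
          rw [mul_assoc, ← Real.exp_add, ← sub_eq_add_neg]
      _ ≤ _ := le_add_of_nonneg_left (by positivity)
  · calc ‖Q.eval (circlePoint t)‖ ^ 2 * deepZeroDensity K p t
        ≤ ‖Q.eval (circlePoint t)‖ ^ 2 :=
          mul_le_of_le_one_right (by positivity) (deepZeroDensity_le_one K p t)
      _ ≤ 12 * Real.exp (-(n * ε ^ 2)) := hQ_off t ht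
      _ ≤ _ := le_add_of_nonneg_right (by positivity)

end UpperBound

section GrowthRate

open Metric

variable {K : Set UnitAddCircle} {θ p B D b lam : ℝ} {n : ℕ}

theorem exp_neg_le_predictionError_of_eq_rpow (hK : K.Nonempty) (hθ : 0 < θ) (hp : θ < p)
    (hB : ∀ δ > 0, volume.real (thickening δ K) ≤ B * δ ^ θ) (hb : 0 < b)
    (hBb : B * b ^ θ = 1 / 64) (hlam : 1 ≤ lam) (hn : (n : ℝ) = lam ^ (p + θ)) :
    Real.exp (-((B * p / (p - θ) * b ^ (θ - p) + b ^ (-p) / 64 + Real.pi + 2) * lam ^ (p - θ))) ≤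
      predictionError (deepZeroMeasure K p) n := by
  have hlam0 : 0 < lam := zero_lt_one.trans_le hlam
  have hδ : 0 < b / lam := by positivity
  have hδ_rpow (x : ℝ) : (b / lam) ^ x = b ^ x * lam ^ (-x) := by
    rw [Real.div_rpow hb.le hlam0.le, Real.rpow_neg hlam0.le, div_eq_mul_inv]
  set ε := lam ^ (-θ) / 64 with hε
  have hε0 : 0 < ε := by positivity
  have hε_le : ε ≤ 1 / 64 := by
    rw [hε]
    gcongr
    exact Real.rpow_le_one_of_one_le_of_nonpos hlam (by linarith)
  have hKε : volume.real (thickening (b / lam) K) ≤ ε := by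
    refine (hB _ hδ).trans_eq ?_
    rw [hδ_rpow, ← mul_assoc, hBb, hε]
    ring
  have hlam_pow : 1 ≤ lam ^ (p - θ) := Real.one_le_rpow hlam (by linarith)
  have hintegral := setIntegral_infDist_rpow_neg_le (μ := volume) hK (hθ.trans hp) hp hB hδ
  rw [hδ_rpow, neg_sub, ← mul_assoc] at hintegral
  have hdepth : ε * (b / lam) ^ (-p) = b ^ (-p) / 64 * lam ^ (p - θ) := by
    rw [hδ_rpow, hε, neg_neg, sub_eq_neg_add, Real.rpow_add hlam0]
    ring
  have hlog : ε * Real.log ε⁻¹ ≤ 1 :=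
    calc ε * Real.log ε⁻¹ ≤ ε * ε⁻¹ :=
          mul_le_mul_of_nonneg_left (Real.log_le_self (by positivity)) hε0.le
      _ = 1 := mul_inv_cancel₀ hε0.ne'
  have hdegree : ε * ε * n = lam ^ (p - θ) / 4096 := by
    rw [hn, hε, show p - θ = -θ + -θ + (p + θ) by ring,
      Real.rpow_add hlam0 (-θ + -θ), Real.rpow_add hlam0 (-θ)]
    ring
  refine le_trans (Real.exp_le_exp.mpr ?_)
    (exp_neg_le_predictionError hK (hθ.trans hp).le hδ hε0 hε_le hKε)
  nlinarith [Real.pi_pos]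

theorem exists_forall_exp_neg_le_predictionError (hK : K.Nonempty) (hθ : 0 < θ) (hp : θ < p)
    (hB0 : 0 < B) (hB : ∀ δ > 0, volume.real (thickening δ K) ≤ B * δ ^ θ) :
    ∃ C > 0, ∀ n : ℕ, 1 ≤ n → Real.exp (-(C * (n : ℝ) ^ ((p - θ) / (p + θ)))) ≤
      predictionError (deepZeroMeasure K p) n := by
  set b := (1 / (64 * B)) ^ θ⁻¹
  have hb : 0 < b := by positivity
  have hBb : B * b ^ θ = 1 / 64 := by
    rw [Real.rpow_inv_rpow (by positivity) hθ.ne']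
    field_simp
  have : 0 < p - θ := by linarith
  have hp0 : 0 < p := hθ.trans hp
  refine ⟨B * p / (p - θ) * b ^ (θ - p) + b ^ (-p) / 64 + Real.pi + 2, by positivity,
    fun n hn => ?_⟩
  rw [div_eq_inv_mul (p - θ) (p + θ), Real.rpow_mul n.cast_nonneg]
  exact exp_neg_le_predictionError_of_eq_rpow hK hθ hp hB hb hBb
    (Real.one_le_rpow (by exact_mod_cast hn) (by positivity))
    (Real.rpow_inv_rpow n.cast_nonneg (by positivity)).symm

theorem le_exp_neg_div_twelve {a x : ℝ} (ha : a ≤ Real.exp (-(1 / 2)))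
    (hax : a ≤ Real.sqrt (16 * Real.exp (-x))) : a ≤ Real.exp (-(x / 12)) := by
  rcases le_total x 6 with hx | hx
  · exact ha.trans (Real.exp_le_exp.mpr (by linarith))
  · have hsixteen : (16 : ℝ) ≤ Real.exp (5 / 6 * x) :=
      calc (16 : ℝ) ≤ Real.exp 1 ^ 5 := by
            have htwo : 2 ≤ Real.exp 1 := by linarith [Real.add_one_le_exp 1]
            exact (by norm_num : (16 : ℝ) ≤ 2 ^ 5).trans (by gcongr)
        _ ≤ Real.exp (5 / 6 * x) := by
            rw [← Real.exp_nat_mul]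
            exact Real.exp_le_exp.mpr (by push_cast; linarith)
    refine hax.trans (Real.sqrt_le_iff.mpr ⟨(Real.exp_pos _).le, ?_⟩)
    calc 16 * Real.exp (-x) ≤ Real.exp (5 / 6 * x) * Real.exp (-x) := by gcongr
      _ = Real.exp (-(x / 12)) ^ 2 := by
        rw [← Real.exp_add, ← Real.exp_nat_mul]
        push_cast
        ring_nf

theorem predictionError_le_exp_neg_of_eq_rpow (hθ : 0 < θ) (hp : θ < p) (hD0 : 0 < D)
    (hD : ∀ ε ∈ Set.Ioo 0 1, ∃ t₀, ∀ t ∈ closedBall t₀ (ε / 2), infDist t K ≤ D * ε ^ θ⁻¹)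
    (hb0 : 0 < b) (hb : b ≤ 1 / 2) (hDb : 5 ≤ (D * b ^ θ⁻¹) ^ (-p)) (hlam : 1 ≤ lam)
    (hn : (n : ℝ) = lam ^ (p + θ)) :
    predictionError (deepZeroMeasure K p) n ≤ Real.exp (-(b ^ 2 * lam ^ (p - θ) / 12)) := by
  have hlam0 : 0 < lam := zero_lt_one.trans_le hlam
  have hp0 : 0 < p := hθ.trans hp
  set ε := b * lam ^ (-θ) with hε
  have hε_mem : ε ∈ Set.Ioo 0 1 := by
    have hlam_le : lam ^ (-θ) ≤ 1 := Real.rpow_le_one_of_one_le_of_nonpos hlam (by linarith)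
    exact ⟨by positivity, by nlinarith⟩
  obtain ⟨t₀, ht₀⟩ := hD ε hε_mem
  have hdegree : n * ε = b * lam ^ p := by
    rw [hn, hε, show p = p + θ + -θ by ring, Real.rpow_add hlam0 (p + θ)]
    ring_nf
  have hdegree_sq : n * ε ^ 2 = b ^ 2 * lam ^ (p - θ) := by
    rw [sq, ← mul_assoc, hdegree, hε, sub_eq_add_neg, Real.rpow_add hlam0]
    ring
  have hdepth : (D * ε ^ θ⁻¹) ^ (-p) = (D * b ^ θ⁻¹) ^ (-p) * lam ^ p := by
    rw [hε, Real.mul_rpow hb0.le (by positivity), ← mul_assoc, ← Real.rpow_mul hlam0.le,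
      Real.mul_rpow (by positivity) (by positivity), ← Real.rpow_mul hlam0.le, neg_mul, neg_mul_neg,
      mul_inv_cancel₀ hθ.ne', one_mul]
  have hexponent : Real.pi * n * ε - (D * ε ^ θ⁻¹) ^ (-p) ≤ -(b ^ 2 * lam ^ (p - θ)) := by
    have hpow : lam ^ (p - θ) ≤ lam ^ p := Real.rpow_le_rpow_of_exponent_le hlam (by linarith)
    rw [hdepth, mul_assoc, hdegree]
    have hpow0 : 0 ≤ lam ^ p := by positivity
    have hgrowth : Real.pi * (b * lam ^ p) ≤ 4 * (1 / 2 * lam ^ p) := by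
      gcongr
      exact Real.pi_le_four
    have hremainder : b ^ 2 * lam ^ (p - θ) ≤ 1 * lam ^ p := by
      gcongr
      exact pow_le_one₀ hb0.le (by linarith)
    have hdecay := mul_le_mul_of_nonneg_right hDb hpow0
    linarith
  refine le_exp_neg_div_twelve (predictionError_le_exp_neg_half hp0.le n)
    ((predictionError_le_sqrt_of_infDist_le hp0.le hε_mem ht₀).trans (Real.sqrt_le_sqrt ?_))
  rw [hdegree_sq]
  linarith [Real.exp_le_exp.mpr hexponent]

theorem exists_forall_predictionError_le_exp_neg (hθ : 0 < θ) (hp : θ < p) (hD0 : 0 < D)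
    (hD : ∀ ε ∈ Set.Ioo 0 1, ∃ t₀, ∀ t ∈ closedBall t₀ (ε / 2), infDist t K ≤ D * ε ^ θ⁻¹) :
    ∃ c > 0, ∀ n : ℕ, 1 ≤ n → predictionError (deepZeroMeasure K p) n ≤
      Real.exp (-(c * (n : ℝ) ^ ((p - θ) / (p + θ)))) := by
  have hp0 : 0 < p := hθ.trans hp
  set β := (D⁻¹ * 5 ^ (-p⁻¹)) ^ θ
  set b := min (1 / 2) β
  have hb0 : 0 < b := lt_min one_half_pos (by positivity)
  have hDb : 5 ≤ (D * b ^ θ⁻¹) ^ (-p) :=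
    calc (5 : ℝ) = (D * β ^ θ⁻¹) ^ (-p) := by
          rw [Real.rpow_rpow_inv (by positivity) hθ.ne', mul_inv_cancel_left₀ hD0.ne',
            ← Real.rpow_mul (by norm_num), neg_mul_neg, inv_mul_cancel₀ hp0.ne', Real.rpow_one]
      _ ≤ (D * b ^ θ⁻¹) ^ (-p) := by
          refine Real.rpow_le_rpow_of_nonpos (by positivity) ?_ (neg_nonpos.mpr hp0.le)
          gcongr
          exact min_le_right _ _
  refine ⟨b ^ 2 / 12, by positivity, fun n hn => ?_⟩
  rw [div_eq_inv_mul (p - θ), Real.rpow_mul n.cast_nonneg, div_mul_eq_mul_div]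
  exact predictionError_le_exp_neg_of_eq_rpow hθ hp hD0 hD hb0 (min_le_left _ _) hDb
    (Real.one_le_rpow (by exact_mod_cast hn) (by positivity))
    (Real.rpow_inv_rpow n.cast_nonneg (by positivity)).symm

end GrowthRate

section PowerSequence

open Metric

variable {ν x ε δ : ℝ}

theorem norm_coe_le_abs (x : ℝ) : ‖(x : UnitAddCircle)‖ ≤ |x| :=
  QuotientAddGroup.norm_mk_le_norm

theorem mem_powerSeqSet {t : UnitAddCircle} : t ∈ powerSeqSet ν ↔
    (∃ k : ℕ, 1 ≤ k ∧ t = (((k : ℝ) ^ (-ν) : ℝ) : UnitAddCircle)) ∨ t = 0 := by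
  have hzero : circlePoint 0 = 1 := by simp [circlePoint]
  have hexp (x : ℝ) : Complex.exp (2 * Real.pi * Complex.I * (x : ℂ)) = circlePoint x := by
    rw [circlePoint_coe]
    push_cast
    ring_nf
  simp only [powerSeqSet, Set.mem_ofPred_eq, hexp, circlePoint_injective.eq_iff]
  rw [← hzero, circlePoint_injective.eq_iff]

theorem zero_mem_powerSeqSet (ν : ℝ) : (0 : UnitAddCircle) ∈ powerSeqSet ν :=
  mem_powerSeqSet.mpr (Or.inr rfl)

theorem one_sub_mul_le_one_add_rpow_neg (hν : 0 ≤ ν) (hx : 0 ≤ x) :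
    1 - ν * x ≤ (1 + x) ^ (-ν) := by
  have hlog : Real.log (1 + x) ≤ x := (Real.log_le_sub_one_of_pos (by linarith)).trans_eq (by ring)
  calc 1 - ν * x ≤ Real.log (1 + x) * -ν + 1 := by nlinarith
    _ ≤ Real.exp (Real.log (1 + x) * -ν) := Real.add_one_le_exp _
    _ = (1 + x) ^ (-ν) := (Real.rpow_def_of_pos (by linarith) _).symm

theorem exists_nat_rpow_neg_mem_Icc (hν : 0 < ν) (hx : 0 < x) :
    ∃ k : ℕ, 1 ≤ k ∧ (k : ℝ) ^ (-ν) ∈ Set.Icc (x - ν * x ^ (1 + 1 / ν)) x := by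
  set a := x ^ (-(1 / ν)) with ha
  have ha0 : 0 < a := by positivity
  have haν : a ^ (-ν) = x := by
    rw [ha, ← Real.rpow_mul hx.le, neg_mul_neg, one_div_mul_cancel hν.ne', Real.rpow_one]
  have hpow : x ^ (1 + 1 / ν) = x * a⁻¹ := by
    rw [Real.rpow_add hx, Real.rpow_one, ha, Real.rpow_neg hx.le, inv_inv]
  have hceil : 0 < ⌈a⌉₊ := Nat.ceil_pos.mpr ha0
  refine ⟨⌈a⌉₊, hceil, ?_, ?_⟩
  · calc x - ν * x ^ (1 + 1 / ν) = x * (1 - ν * a⁻¹) := by rw [hpow]; ring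
      _ ≤ a ^ (-ν) * (1 + a⁻¹) ^ (-ν) := by
        rw [haν]
        gcongr
        exact one_sub_mul_le_one_add_rpow_neg hν.le (by positivity)
      _ = (a + 1) ^ (-ν) := by
        rw [← Real.mul_rpow ha0.le (by positivity), mul_one_add, mul_inv_cancel₀ ha0.ne']
      _ ≤ (⌈a⌉₊ : ℝ) ^ (-ν) := Real.rpow_le_rpow_of_nonpos (by exact_mod_cast hceil)
        (Nat.ceil_lt_add_one ha0.le).le (neg_nonpos.mpr hν.le)
  · exact (Real.rpow_le_rpow_of_nonpos ha0 (Nat.le_ceil a) (neg_nonpos.mpr hν.le)).trans_eq haν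

theorem infDist_coe_powerSeqSet_le (hν : 0 < ν) (hx : 0 ≤ x) :
    infDist (x : UnitAddCircle) (powerSeqSet ν) ≤ ν * x ^ (1 + 1 / ν) := by
  rcases hx.eq_or_lt with rfl | hx0
  · rw [AddCircle.coe_zero, infDist_zero_of_mem (zero_mem_powerSeqSet ν)]
    positivity
  obtain ⟨k, hk, hle, hge⟩ := exists_nat_rpow_neg_mem_Icc hν hx0
  refine (infDist_le_dist_of_mem (mem_powerSeqSet.mpr (Or.inl ⟨k, hk, rfl⟩))).trans ?_
  rw [dist_eq_norm, ← AddCircle.coe_sub]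
  refine (norm_coe_le_abs _).trans ?_
  rw [abs_of_nonneg (sub_nonneg.mpr hge)]
  linarith

theorem exists_coe_eq_of_mem_closedBall {t : UnitAddCircle} {c r : ℝ}
    (ht : t ∈ closedBall (c : UnitAddCircle) r) : ∃ x ∈ Set.Icc (c - r) (c + r), ↑x = t := by
  obtain ⟨y, hy, hnorm⟩ := exists_coe_eq_and_abs_eq_norm (t - c)
  rw [mem_closedBall, dist_eq_norm, ← hnorm, abs_le] at ht
  exact ⟨c + y, ⟨by linarith, by linarith⟩, by rw [AddCircle.coe_add, hy, add_sub_cancel]⟩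

theorem exists_forall_mem_closedBall_infDist_powerSeqSet_le (hν : 0 < ν) (ε : ℝ) :
    ∃ t₀ : UnitAddCircle, ∀ t ∈ closedBall t₀ (ε / 2),
      infDist t (powerSeqSet ν) ≤ ν * ε ^ (1 + 1 / ν) := by
  refine ⟨((ε / 2 : ℝ) : UnitAddCircle), fun t ht => ?_⟩
  obtain ⟨x, ⟨hx0, hxε⟩, rfl⟩ := exists_coe_eq_of_mem_closedBall ht
  rw [sub_self] at hx0
  rw [add_halves] at hxε
  refine (infDist_coe_powerSeqSet_le hν hx0).trans ?_
  gcongr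

theorem volume_real_closedBall_le (t : UnitAddCircle) (hδ : 0 ≤ δ) :
    volume.real (closedBall t δ) ≤ 2 * δ := by
  rw [measureReal_def, AddCircle.volume_closedBall, ENNReal.toReal_ofReal (by positivity)]
  exact min_le_right _ _

theorem thickening_powerSeqSet_subset (hν : 0 ≤ ν) (δ : ℝ) {m : ℕ} (hm : 0 < m) :
    thickening δ (powerSeqSet ν) ⊆ closedBall 0 ((m : ℝ) ^ (-ν) + δ) ∪
      ⋃ k ∈ Finset.range m, closedBall (((k : ℝ) ^ (-ν) : ℝ) : UnitAddCircle) δ := by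
  intro t ht
  obtain ⟨s, hs, hts⟩ := mem_thickening_iff.mp ht
  have of_norm_le (hs : ‖s‖ ≤ (m : ℝ) ^ (-ν)) : t ∈ closedBall 0 ((m : ℝ) ^ (-ν) + δ) := by
    rw [mem_closedBall]
    linarith [dist_triangle t s 0, dist_zero_right s]
  rcases mem_powerSeqSet.mp hs with ⟨k, -, rfl⟩ | rfl
  · rcases lt_or_ge k m with hkm | hmk
    · exact Or.inr (Set.mem_biUnion (Finset.mem_range.mpr hkm) hts.le)
    · refine Or.inl (of_norm_le ((norm_coe_le_abs _).trans ?_))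
      rw [abs_of_nonneg (by positivity)]
      exact Real.rpow_le_rpow_of_nonpos (by exact_mod_cast hm) (by exact_mod_cast hmk)
        (neg_nonpos.mpr hν)
  · exact Or.inl (of_norm_le (norm_zero.trans_le (by positivity)))

theorem volume_real_thickening_powerSeqSet_le_add (hν : 0 ≤ ν) (hδ : 0 ≤ δ) {m : ℕ} (hm : 0 < m) :
    volume.real (thickening δ (powerSeqSet ν)) ≤ 2 * ((m : ℝ) ^ (-ν) + δ) + m * (2 * δ) := by
  refine (measureReal_mono (thickening_powerSeqSet_subset hν δ hm) (measure_ne_top _ _)).trans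
    ((measureReal_union_le _ _).trans (add_le_add
      (volume_real_closedBall_le _ (by positivity)) ?_))
  refine (measureReal_biUnion_finset_le _ _).trans
    ((Finset.sum_le_sum fun _ _ => volume_real_closedBall_le _ hδ).trans_eq ?_)
  rw [Finset.sum_const, Finset.card_range, nsmul_eq_mul]

theorem volume_real_thickening_powerSeqSet_le (hν : 0 < ν) (hδ : 0 < δ) :
    volume.real (thickening δ (powerSeqSet ν)) ≤ 8 * δ ^ (ν / (ν + 1)) := by
  rcases le_total 1 δ with hδ1 | hδ1
  · have hpow : 1 ≤ δ ^ (ν / (ν + 1)) := Real.one_le_rpow hδ1 (by positivity)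
    have huniv : volume.real (thickening δ (powerSeqSet ν)) ≤ 1 := measureReal_le_one
    linarith
  -- `m ≈ δ ^ (-1 / (ν + 1))` balances `m ^ (-ν)` against `m * δ`
  set a := δ ^ (-(1 / (ν + 1))) with ha
  have ha0 : 0 < a := by positivity
  have hceil : a ≤ ⌈a⌉₊ := Nat.le_ceil a
  have htail : (⌈a⌉₊ : ℝ) ^ (-ν) ≤ δ ^ (ν / (ν + 1)) :=
    calc (⌈a⌉₊ : ℝ) ^ (-ν) ≤ a ^ (-ν) :=
          Real.rpow_le_rpow_of_nonpos ha0 hceil (neg_nonpos.mpr hν.le)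
      _ = δ ^ (ν / (ν + 1)) := by
          rw [ha, ← Real.rpow_mul hδ.le, neg_mul_neg, one_div_mul_eq_div]
  have hhead : a * δ = δ ^ (ν / (ν + 1)) := by
    rw [ha, ← Real.rpow_add_one hδ.ne']
    congr 1
    field_simp
    ring
  have hδ_le : δ ≤ δ ^ (ν / (ν + 1)) := by
    conv_lhs => rw [← Real.rpow_one δ]
    exact Real.rpow_le_rpow_of_exponent_ge hδ hδ1 ((div_le_one (by linarith)).mpr (by linarith))
  have hcover := volume_real_thickening_powerSeqSet_le_add hν.le hδ.le (Nat.ceil_pos.mpr ha0)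
  have hnum : ⌈a⌉₊ * δ ≤ (a + 1) * δ := by
    gcongr
    exact (Nat.ceil_lt_add_one ha0.le).le
  linarith

end PowerSequence

theorem mainTheorem6_general {K : Set UnitAddCircle} {θ p B D : ℝ} (hK : K.Nonempty) (hθ : 0 < θ)
    (hp : θ < p) (hB : ∀ δ > 0, volume.real (Metric.thickening δ K) ≤ B * δ ^ θ) (hD0 : 0 < D)
    (hD : ∀ ε ∈ Set.Ioo 0 1, ∃ t₀, ∀ t ∈ Metric.closedBall t₀ (ε / 2),
      Metric.infDist t K ≤ D * ε ^ θ⁻¹) :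
    ∃ c C : ℝ, 0 < c ∧ 0 < C ∧ ∀ n : ℕ, 1 ≤ n →
      c * (n : ℝ) ^ ((p - θ) / (p + θ)) ≤ |Real.log (predictionError (deepZeroMeasure K p) n)| ∧
        |Real.log (predictionError (deepZeroMeasure K p) n)| ≤
          C * (n : ℝ) ^ ((p - θ) / (p + θ)) := by
  obtain ⟨c, hc, hupper⟩ := exists_forall_predictionError_le_exp_neg hθ hp hD0 hD
  have hthick : Metric.thickening 1 K = Set.univ := Set.eq_univ_of_forall fun t =>
    (Metric.mem_thickening_iff_infDist_lt hK).mpr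
      ((infDist_le_half K t).trans_lt one_half_lt_one)
  have hB0 : 0 < B := by
    have hone := hB 1 one_pos
    rw [hthick, probReal_univ, Real.one_rpow, mul_one] at hone
    exact one_pos.trans_le hone
  obtain ⟨C, hC, hlower⟩ := exists_forall_exp_neg_le_predictionError hK hθ hp hB0 hB
  refine ⟨c, C, hc, hC, fun n hn => ?_⟩
  have hpos := (Real.exp_pos _).trans_le (hlower n hn)
  have hlog_le := (Real.log_le_iff_le_exp hpos).mpr (hupper n hn)
  have hle_log := (Real.le_log_iff_exp_le hpos).mpr (hlower n hn)
  have hrate : 0 ≤ c * (n : ℝ) ^ ((p - θ) / (p + θ)) := by positivity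
  rw [abs_of_nonpos (by linarith)]
  exact ⟨le_neg.mpr hlog_le, neg_le.mpr hle_log⟩

theorem mainTheorem6 (ν p : ℝ) (hν : 0 < ν) (hp : ν / (ν + 1) < p) :
    ∃ c C : ℝ, 0 < c ∧ 0 < C ∧ ∀ n : ℕ, 1 ≤ n →
      c * (n : ℝ) ^ ((p - ν / (ν + 1)) / (p + ν / (ν + 1))) ≤
          |Real.log (predictionError (deepZeroMeasure (powerSeqSet ν) p) n)| ∧
        |Real.log (predictionError (deepZeroMeasure (powerSeqSet ν) p) n)| ≤
          C * (n : ℝ) ^ ((p - ν / (ν + 1)) / (p + ν / (ν + 1))) :=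
  mainTheorem6_general ⟨0, zero_mem_powerSeqSet ν⟩ (by positivity) hp
    (fun _ => volume_real_thickening_powerSeqSet_le hν) hν fun ε _ => by
      rw [inv_div, add_div, div_self hν.ne']
      exact exists_forall_mem_closedBall_infDist_powerSeqSet_le hν ε
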